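/- Let $(\mathcal{A},\tau)$ be a unital $C^*$-algebra with a tracial state (for instance a tracial $W^*$-probability space). Let $(Y_t)_{t\ge 0}$ be a free unitary Brownian motion in $(\mathcal{A},\tau)$, i.e. a norm-continuous process of unitaries with $Y_0=1$, adapted to a filtration carrying a free additive Brownian motion $(X_t)_{t\ge0}$, and solving the free stochastic differential equation $dY_t = iY_t\,dX_t-\tfrac12 Y_t\,dt$. Let $P=P^*=P^2\in\mathcal{A}$ be a projection with $\tau(P)=\alpha\in(0,1]$ such that $P$ and $(Y_t)_{t\ge 0}$ are $*$-free. Put $Q_n(t):=e^{nt/2}\,\tau(Y_t^n)$ for $n\ge 0$, $t\ge0$. Then $Q_0\equiv 1$ and, for all $n\ge1$ and $t\ge0$, $$Q_n(t)=\frac1n L^{(1)}_{n-1}(nt)=\frac1n\sum_{r=0}^{n-1}\binom{n}{r+1}\frac{(-nt)^r}{r!},$$ where $L^{(1)}_{n-1}$ is the Laguerre polynomial of degree $n-1$ and parameter $1$; and, for all $n\ge 1$ and $t\ge 0$, $$\tau\big[(PY_t)^n\big]=\tau\big[(PY_tP)^n\big]=\alpha\, e^{-nt/2}\,Q_n(\alpha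 t).$$ Equivalently, for all $n\ge 0$ and $t\ge0$, $\tau\big[(PY_t)^nP\big]=\alpha\, e^{-nt/2}\,Q_n(\alpha t)$; that is, the formula also holds for $n=0$ when the zeroth power is taken in the compressed algebra $P\mathcal{A}P$, whose unit is $P$. -/

import Mathlib

open scoped NNReal ComplexOrder

noncomputable section

namespace FreeProb

variable {A : Type*} [CStarAlgebra A]

/-- `τ` is a tracial state on the unital C*-algebra `A`. -/
structure IsTracialState (τ : A →ₗ[ℂ] ℂ) : Prop where
  map_one : τ 1 = 1
  nonneg : ∀ a : A, 0 ≤ τ (star a * a)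
  trace : ∀ a b : A, τ (a * b) = τ (b * a)

/-- Freeness, in the sense of Voiculescu, of a family of unital *-subalgebras: every nonempty
alternating product of centered elements is centered. The list records the factors, each one
together with the index of the subalgebra it is taken from. -/
def IsFreeFamily (τ : A →ₗ[ℂ] ℂ) {ι : Type*} (S : ι → StarSubalgebra ℂ A) : Prop :=
  ∀ l : List (ι × A), l ≠ [] → l.IsChain (fun x y => x.1 ≠ y.1) →
    (∀ x ∈ l, x.2 ∈ S x.1 ∧ τ x.2 = 0) → τ (l.map Prod.snd).prod = 0

/-- Freeness of two unital *-subalgebras. -/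
def IsFreePair (τ : A →ₗ[ℂ] ℂ) (S T : StarSubalgebra ℂ A) : Prop :=
  IsFreeFamily τ ![S, T]

/-- Two sets of elements are *-free: the unital *-subalgebras which they generate are free. -/
def IsStarFree (τ : A →ₗ[ℂ] ℂ) (s t : Set A) : Prop :=
  IsFreePair τ (StarAlgebra.adjoin ℂ s) (StarAlgebra.adjoin ℂ t)

/-- `x` is self-adjoint and its distribution is the centered semicircle law of variance `v`:
the odd moments vanish and the moment of order `2 m` is `v ^ m` times the Catalan number `C_m`. -/
structure IsSemicircular (τ : A →ₗ[ℂ] ℂ) (x : A) (v : ℝ≥0) : Prop where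
  selfAdjoint : IsSelfAdjoint x
  even_moment : ∀ m : ℕ, τ (x ^ (2 * m)) = (catalan m : ℂ) * ((v : ℝ) : ℂ) ^ m
  odd_moment : ∀ m : ℕ, τ (x ^ (2 * m + 1)) = 0

/-- `X` is a (standard) free additive Brownian motion with respect to the filtration `F`. -/
structure IsFreeBrownianMotion (τ : A →ₗ[ℂ] ℂ) (F : ℝ≥0 → StarSubalgebra ℂ A)
    (X : ℝ≥0 → A) : Prop where
  filtration_mono : Monotone F
  adapted : ∀ t, X t ∈ F t
  zero : X 0 = 0
  semicircular : ∀ s t, s ≤ t → IsSemicircular τ (X t - X s) (t - s)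
  free : ∀ s t, s ≤ t → IsFreePair τ (F s) (StarAlgebra.adjoin ℂ {X t - X s})

/-- `J` is the free Itô integral `∫₀ᵗ H_s dX_s` of the (norm continuous, adapted) process `H`:
the limit in norm of the left-endpoint Riemann sums over the subdivisions
`0 = s 0 ≤ s 1 ≤ ⋯ ≤ s N = t`, as their mesh tends to `0`. -/
def HasFreeItoIntegral (H X : ℝ≥0 → A) (t : ℝ≥0) (J : A) : Prop :=
  ∀ ε : ℝ, 0 < ε → ∃ δ : ℝ, 0 < δ ∧ ∀ (N : ℕ) (s : ℕ → ℝ≥0), Monotone s → s 0 = 0 → s N = t →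
    (∀ j < N, (s (j + 1) : ℝ) - (s j : ℝ) < δ) →
      ‖(∑ j ∈ Finset.range N, H (s j) * (X (s (j + 1)) - X (s j))) - J‖ < ε

/-- `Y` is a free unitary Brownian motion: a norm continuous process of unitaries, adapted to a
filtration which carries a free additive Brownian motion `X`, such that `Y₀ = 1` and
`dY_t = i Y_t dX_t - (1/2) Y_t dt`, that is
`Y_t = 1 + i ∫₀ᵗ Y_s dX_s - (1/2) ∫₀ᵗ Y_s ds` for every `t`. -/
structure IsFreeUnitaryBrownianMotion (τ : A →ₗ[ℂ] ℂ) (Y : ℝ≥0 → A) : Prop where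
  unitary : ∀ t, Y t ∈ unitary A
  continuous : Continuous Y
  sde : ∃ (F : ℝ≥0 → StarSubalgebra ℂ A) (X : ℝ≥0 → A),
    IsFreeBrownianMotion τ F X ∧ (∀ t, Y t ∈ F t) ∧
      ∀ t : ℝ≥0, ∃ J : A, HasFreeItoIntegral Y X t J ∧
        Y t = 1 + Complex.I • J
          - (1 / 2 : ℂ) • ∫ s in (0 : ℝ)..(t : ℝ), Y s.toNNReal

/-- `Q_n(t) = e^{nt/2} τ(Y_t^n)`. -/
def momentQ (τ : A →ₗ[ℂ] ℂ) (Y : ℝ≥0 → A) (n : ℕ) (t : ℝ≥0) : ℂ :=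
  Complex.exp ((n : ℂ) * ((t : ℝ) : ℂ) / 2) * τ (Y t ^ n)

/-- The generalized Laguerre polynomial `L_k^{(a)}`, for a natural number `a`, as a function. -/
def laguerre (a k : ℕ) (x : ℂ) : ℂ :=
  ∑ r ∈ Finset.range (k + 1), (-1) ^ r * (Nat.choose (k + a) (k - r) : ℂ) * x ^ r / (Nat.factorial r : ℂ)

end FreeProb

end

/-! For `a`, `b` in the past, freeness of the increments gives the Itô rule `τ(a dX b dX) = τ(a)
τ(b) dt`. Expanding `(Y + dY)^n` to first order in `dt` therefore yields, after the factor
`e^{nt/2}` has absorbed the drift, `Q_n' = -(n/2) ∑_{0<p<n} Q_p Q_{n-p}` with `Q_n(0) = 1`. This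
triangular system determines every `Q_n` (`hasDerivWithinAt_momentQ`).

Its solution is read off from Lagrange inversion. Put `φ_t(y) = (1 + y) e^{-ty}`, `F_t(y) = y /
φ_t(y)`, and let `Ψ_t` be the compositional inverse of `F_t`. The coefficients of `Ψ_t` are
`[y^{n-1}] φ_t^n / n`, which are the Laguerre values. Those of `Ψ_t²` are `(2/n) [y^{n-2}] φ_t^n`,
and `∂_t φ_t^n = -n y φ_t^n` turns this into the same system, so `Ψ_t = ∑_{n≥1} Q_n(t) z^n`
(`momentQ_eq`).

The compression step is the multiplicativity of the S-transform, for a projection. If `P` is free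
from `b` and `τ((1 - s b)⁻¹) = 1 + y`, then `τ((1 - ζ P b)⁻¹) = 1 + y` for `ζ = s (1 + y) / (α + y)`
(`eventually_apply_inverse`). With `b = Y_t`, `y = α u` and `s = e^{t/2} F_t(α u)`, this `ζ` equals
`e^{t/2} F_{αt}(u)`. Hence the moment series of `P Y_t` at `e^{t/2} v` is `1 + α Ψ_{αt}(v)`, and
comparing coefficients gives the formula. -/

noncomputable section

namespace FreeProb

/-! ### Tracial states and low-order consequences of freeness -/

section TracialState

variable {A : Type*} [CStarAlgebra A]

namespace IsTracialState

variable {τ : A →ₗ[ℂ] ℂ}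

/-- Equipping `A` with its spectral order makes the GNS semi-inner product available, and with it
Cauchy–Schwarz. -/
theorem exists_positiveLinearMap (hτ : IsTracialState τ) :
    let _ := CStarAlgebra.spectralOrder A
    let _ := CStarAlgebra.spectralOrderedRing A
    ∃ f : A →ₚ[ℂ] ℂ, ∀ a, f a = τ a := by
  let _ := CStarAlgebra.spectralOrder A
  let _ := CStarAlgebra.spectralOrderedRing A
  refine ⟨PositiveLinearMap.mk₀ τ fun x hx => ?_, fun a => rfl⟩
  obtain ⟨s, rfl⟩ := CStarAlgebra.nonneg_iff_eq_star_mul_self.mp hx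
  exact hτ.nonneg s

/-- The Cauchy–Schwarz inequality. -/
theorem norm_apply_star_mul_le (hτ : IsTracialState τ) (x y : A) :
    ‖τ (star x * y)‖ ≤ √(τ (star x * x)).re * √(τ (star y * y)).re := by
  let _ := CStarAlgebra.spectralOrder A
  let _ := CStarAlgebra.spectralOrderedRing A
  obtain ⟨f, hf⟩ := hτ.exists_positiveLinearMap
  have h := norm_inner_le_norm (𝕜 := ℂ) (f.toPreGNS x) (f.toPreGNS y)
  rw [PositiveLinearMap.preGNS_inner_def, PositiveLinearMap.preGNS_norm_def,
    PositiveLinearMap.preGNS_norm_def] at h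
  simp only [PositiveLinearMap.ofPreGNS_toPreGNS, hf] at h
  exact h

theorem re_nonneg (hτ : IsTracialState τ) (a : A) : 0 ≤ (τ (star a * a)).re :=
  (Complex.nonneg_iff.mp (hτ.nonneg a)).1

theorem re_star_mul_le (hτ : IsTracialState τ) (b a : A) :
    (τ (star (b * a) * (b * a))).re ≤ ‖b‖ ^ 2 * (τ (star a * a)).re := by
  let _ := CStarAlgebra.spectralOrder A
  let _ := CStarAlgebra.spectralOrderedRing A
  obtain ⟨f, hf⟩ := hτ.exists_positiveLinearMap
  have h1 : star a * (star b * b) * a ≤ star a * algebraMap ℝ A (‖b‖ ^ 2) * a :=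
    star_left_conjugate_le_conjugate CStarAlgebra.star_mul_le_algebraMap_norm_sq a
  have h2 := f.monotone' h1
  have h3 : star a * algebraMap ℝ A (‖b‖ ^ 2) * a = ((‖b‖ ^ 2 : ℝ) : ℂ) • (star a * a) := by
    rw [Algebra.algebraMap_eq_smul_one, mul_smul_comm, smul_mul_assoc, mul_one,
      Complex.coe_smul]
  have h4 : f (star a * (star b * b) * a) ≤ f (star a * algebraMap ℝ A (‖b‖ ^ 2) * a) := h2
  rw [h3, map_smul, hf, hf, smul_eq_mul] at h4
  have h5 := (Complex.le_def.mp h4).1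
  rw [Complex.re_ofReal_mul] at h5
  simpa only [star_mul, mul_assoc] using h5

theorem norm_apply_le (hτ : IsTracialState τ) (a : A) : ‖τ a‖ ≤ ‖a‖ := by
  have h := hτ.norm_apply_star_mul_le 1 a
  have h2 := hτ.re_star_mul_le a 1
  simp only [star_one, one_mul, mul_one, hτ.map_one, Complex.one_re, Real.sqrt_one] at h h2
  exact h.trans ((Real.sqrt_le_sqrt h2).trans (Real.sqrt_sq (norm_nonneg a)).le)

theorem continuous (hτ : IsTracialState τ) : Continuous τ :=
  AddMonoidHomClass.continuous_of_bound τ 1 fun x => by simpa using hτ.norm_apply_le x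

/-- A bound for `τ (x K y K)` which is quadratic in the `L²` norm of `K`. -/
theorem norm_apply_mul_mul_le (hτ : IsTracialState τ) (x y k : A) :
    ‖τ (x * k * (y * k))‖ ≤ ‖x‖ * ‖y‖ * (τ (star k * k)).re := by
  have h := hτ.norm_apply_star_mul_le (star (x * k)) (y * k)
  -- Traciality moves the adjoint to the left, so that `k` stands on the right in both square roots.
  rw [star_star, hτ.trace (x * k) (star (x * k))] at h
  have key : ∀ b : A, √(τ (star (b * k) * (b * k))).re ≤ ‖b‖ * √(τ (star k * k)).re := by
    intro b
    refine (Real.sqrt_le_sqrt (hτ.re_star_mul_le b k)).trans ?_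
    rw [Real.sqrt_mul (sq_nonneg _), Real.sqrt_sq (norm_nonneg b)]
  refine h.trans ((mul_le_mul (key x) (key y) (Real.sqrt_nonneg _) (by positivity)).trans ?_)
  rw [mul_mul_mul_comm, Real.mul_self_sqrt (hτ.re_nonneg k)]

end IsTracialState

section Free

variable {τ : A →ₗ[ℂ] ℂ} {S T : StarSubalgebra ℂ A}

theorem centered_mem (h1 : τ 1 = 1) {f : A} (hf : f ∈ S) :
    f - τ f • (1 : A) ∈ S ∧ τ (f - τ f • (1 : A)) = 0 :=
  ⟨sub_mem hf (S.smul_mem (one_mem S) _), by simp [h1]⟩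

theorem IsFreePair.apply_mul_eq_zero (h : IsFreePair τ S T) (h1 : τ 1 = 1)
    {f d : A} (hf : f ∈ S) (hd : d ∈ T) (hd0 : τ d = 0) : τ (f * d) = 0 := by
  obtain ⟨hm, h0⟩ := centered_mem h1 hf
  have := h [(0, f - τ f • (1 : A)), (1, d)] (by simp) (by simp)
    (by simpa using ⟨⟨hm, by simpa using h0⟩, hd, hd0⟩)
  simpa [sub_mul, hd0] using this

theorem IsFreePair.apply_mul (h : IsFreePair τ S T) (h1 : τ 1 = 1)
    {f d : A} (hf : f ∈ S) (hd : d ∈ T) : τ (f * d) = τ f * τ d := by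
  obtain ⟨hm, h0⟩ := centered_mem h1 hd
  have := h.apply_mul_eq_zero h1 hf hm h0
  simp only [mul_sub, mul_smul_comm, mul_one, map_sub, map_smul, smul_eq_mul] at this
  linear_combination this

/-- The free Itô rule. After centering `f` and `g`, the alternating word vanishes; every correction
term has two adjacent `d`'s, up to cyclic rotation, and factorizes. -/
theorem IsFreePair.apply_mul_mul_mul (h : IsFreePair τ S T) (hτ : IsTracialState τ)
    {f g d : A} (hf : f ∈ S) (hg : g ∈ S) (hd : d ∈ T) (hd0 : τ d = 0) :
    τ (f * d * (g * d)) = τ f * τ g * τ (d * d) := by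
  have h1 := hτ.map_one
  obtain ⟨hfm, hf0⟩ := centered_mem h1 hf
  obtain ⟨hgm, hg0⟩ := centered_mem h1 hg
  have h4 := h [(0, f - τ f • (1 : A)), (1, d), (0, g - τ g • (1 : A)), (1, d)] (by simp) (by simp)
    (by simpa using ⟨⟨hfm, by simpa using hf0⟩, ⟨hd, hd0⟩, ⟨hgm, by simpa using hg0⟩, hd, hd0⟩)
  have e1 := h.apply_mul h1 hf (mul_mem hd hd)
  have e2 := h.apply_mul h1 hg (mul_mem hd hd)
  have e3 : τ (d * (g * d)) = τ (g * (d * d)) := by rw [hτ.trace]; simp only [mul_assoc]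
  simp only [List.map_cons, List.map_nil, List.prod_cons, List.prod_nil, mul_one, sub_mul, mul_sub,
    smul_mul_assoc, mul_smul_comm, one_mul, map_sub, map_smul, smul_eq_mul, e1, e2, e3] at h4
  simp only [mul_assoc] at h4 ⊢
  linear_combination h4

end Free

end TracialState

/-! ### Riemann sums and increments of the free Itô integral -/

section ItoIntegral

variable {A : Type*} [CStarAlgebra A]

section Ito

variable {τ : A →ₗ[ℂ] ℂ} {F : ℝ≥0 → StarSubalgebra ℂ A} {X : ℝ≥0 → A}

/-- The left-endpoint Riemann sum of a sequence of integrands `H` against `X` over the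
subdivision `s`. -/
def itoSum (X : ℝ≥0 → A) (s : ℕ → ℝ≥0) (H : ℕ → A) (N : ℕ) : A :=
  ∑ j ∈ Finset.range N, H j * (X (s (j + 1)) - X (s j))

theorem itoSum_succ (X : ℝ≥0 → A) (s : ℕ → ℝ≥0) (H : ℕ → A) (N : ℕ) :
    itoSum X s H (N + 1) = itoSum X s H N + H N * (X (s (N + 1)) - X (s N)) :=
  Finset.sum_range_succ _ _

theorem mul_itoSum (X : ℝ≥0 → A) (s : ℕ → ℝ≥0) (H : ℕ → A) (N : ℕ) (a : A) :
    a * itoSum X s H N = itoSum X s (fun j => a * H j) N := by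
  simp only [itoSum, Finset.mul_sum, mul_assoc]

namespace IsFreeBrownianMotion

theorem apply_increment (hX : IsFreeBrownianMotion τ F X) {s t : ℝ≥0} (h : s ≤ t) :
    τ (X t - X s) = 0 := by
  simpa using (hX.semicircular s t h).odd_moment 0

theorem apply_increment_sq (hX : IsFreeBrownianMotion τ F X) {s t : ℝ≥0} (h : s ≤ t) :
    τ ((X t - X s) * (X t - X s)) = ((t : ℝ) : ℂ) - ((s : ℝ) : ℂ) := by
  have := (hX.semicircular s t h).even_moment 1
  rw [mul_one, pow_two, NNReal.coe_sub h] at this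
  simpa [catalan_one] using this

theorem increment_mem (hX : IsFreeBrownianMotion τ F X) {s t : ℝ≥0} (h : s ≤ t) :
    X t - X s ∈ F t :=
  sub_mem (hX.adapted t) (hX.filtration_mono h (hX.adapted s))

theorem apply_mul_increment (hX : IsFreeBrownianMotion τ F X) (hτ : IsTracialState τ)
    {s t : ℝ≥0} (h : s ≤ t) {f : A} (hf : f ∈ F s) : τ (f * (X t - X s)) = 0 :=
  (hX.free s t h).apply_mul_eq_zero hτ.map_one hf
    (StarAlgebra.subset_adjoin ℂ _ (Set.mem_singleton _)) (hX.apply_increment h)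

theorem itoSum_mem (hX : IsFreeBrownianMotion τ F X) {s : ℕ → ℝ≥0} (hs : Monotone s)
    {H : ℕ → A} (hH : ∀ j, H j ∈ F (s j)) (N : ℕ) : itoSum X s H N ∈ F (s N) :=
  sum_mem fun j hj => by
    have hj' : j + 1 ≤ N := Finset.mem_range.mp hj
    exact mul_mem (hX.filtration_mono (hs (by omega)) (hH j))
      (hX.filtration_mono (hs hj') (hX.increment_mem (hs (Nat.le_succ j))))

theorem apply_itoSum (hX : IsFreeBrownianMotion τ F X) (hτ : IsTracialState τ)
    {s : ℕ → ℝ≥0} (hs : Monotone s) {H : ℕ → A} (hH : ∀ j, H j ∈ F (s j)) (N : ℕ) :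
    τ (itoSum X s H N) = 0 := by
  rw [itoSum, map_sum]
  exact Finset.sum_eq_zero fun j _ => hX.apply_mul_increment hτ (hs (Nat.le_succ j)) (hH j)

/-- Cross terms vanish: traciality brings the latest increment to the right of a factor from its
past. The Itô rule evaluates the diagonal terms. -/
theorem apply_itoSum_mul_itoSum (hX : IsFreeBrownianMotion τ F X) (hτ : IsTracialState τ)
    {s : ℕ → ℝ≥0} (hs : Monotone s) {H G : ℕ → A} (hH : ∀ j, H j ∈ F (s j))
    (hG : ∀ j, G j ∈ F (s j)) (N : ℕ) :
    τ (itoSum X s H N * itoSum X s G N) =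
      ∑ j ∈ Finset.range N, τ (H j) * τ (G j) * (((s (j + 1) : ℝ) : ℂ) - ((s j : ℝ) : ℂ)) := by
  induction N with
  | zero => simp [itoSum]
  | succ N ih =>
    have hN : s N ≤ s (N + 1) := hs (Nat.le_succ N)
    rw [Finset.sum_range_succ, ← ih, itoSum_succ, itoSum_succ]
    set d := X (s (N + 1)) - X (s N)
    have e1 : τ (itoSum X s H N * (G N * d)) = 0 := by
      rw [← mul_assoc]
      exact hX.apply_mul_increment hτ hN (mul_mem (hX.itoSum_mem hs hH N) (hG N))
    have e2 : τ (H N * d * itoSum X s G N) = 0 := by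
      rw [hτ.trace, ← mul_assoc]
      exact hX.apply_mul_increment hτ hN (mul_mem (hX.itoSum_mem hs hG N) (hH N))
    have e3 : τ (H N * d * (G N * d)) =
        τ (H N) * τ (G N) * (((s (N + 1) : ℝ) : ℂ) - ((s N : ℝ) : ℂ)) := by
      rw [← hX.apply_increment_sq hN]
      exact (hX.free _ _ hN).apply_mul_mul_mul hτ (hH N) (hG N)
        (StarAlgebra.subset_adjoin ℂ _ (Set.mem_singleton _)) (hX.apply_increment hN)
    rw [add_mul, mul_add, mul_add, map_add, map_add, map_add, e1, e2, e3]
    ring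

theorem apply_star_itoSum_mul_itoSum (hX : IsFreeBrownianMotion τ F X) (hτ : IsTracialState τ)
    {s : ℕ → ℝ≥0} (hs : Monotone s) {H : ℕ → A} (hH : ∀ j, H j ∈ F (s j))
    (hu : ∀ j, H j ∈ unitary A) (N : ℕ) :
    τ (star (itoSum X s H N) * itoSum X s H N) = ((s N : ℝ) : ℂ) - ((s 0 : ℝ) : ℂ) := by
  induction N with
  | zero => simp [itoSum]
  | succ N ih =>
    have hN : s N ≤ s (N + 1) := hs (Nat.le_succ N)
    have hd := (hX.semicircular _ _ hN).selfAdjoint.star_eq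
    have hsq := hX.apply_increment_sq hN
    have hinc : ∀ f ∈ F (s N), τ (f * (X (s (N + 1)) - X (s N))) = 0 :=
      fun f hf => hX.apply_mul_increment hτ hN hf
    rw [itoSum_succ]
    set d := X (s (N + 1)) - X (s N)
    have e1 : τ (star (itoSum X s H N) * (H N * d)) = 0 := by
      rw [← mul_assoc]
      exact hinc _ (mul_mem (star_mem (hX.itoSum_mem hs hH N)) (hH N))
    have e2 : τ (d * star (H N) * itoSum X s H N) = 0 := by
      rw [mul_assoc, hτ.trace]
      exact hinc _ (mul_mem (star_mem (hH N)) (hX.itoSum_mem hs hH N))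
    have e3 : d * star (H N) * (H N * d) = d * d := by
      rw [mul_assoc, ← mul_assoc (star (H N)), Unitary.star_mul_self_of_mem (hu N), one_mul]
    rw [star_add, star_mul, hd, add_mul, mul_add, mul_add, map_add, map_add, map_add, e1, e2, e3,
      ih, hsq]
    ring

end IsFreeBrownianMotion

variable {Y : ℝ≥0 → A}

/-- An increment of the Itô integral is a limit of Riemann sums over the same interval. -/
theorem HasFreeItoIntegral.sub_mem_closure {t u : ℝ≥0} (htu : t ≤ u) {J K : A}
    (hJ : HasFreeItoIntegral Y X t J) (hK : HasFreeItoIntegral Y X u K) :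
    K - J ∈ closure {S : A | ∃ (N : ℕ) (s : ℕ → ℝ≥0), Monotone s ∧ s 0 = t ∧ s N = u ∧
      S = itoSum X s (fun j => Y (s j)) N} := by
  rw [Metric.mem_closure_iff]
  intro ε hε
  obtain ⟨δ₁, hδ₁, h₁⟩ := hJ (ε / 2) (half_pos hε)
  obtain ⟨δ₂, hδ₂, h₂⟩ := hK (ε / 2) (half_pos hε)
  obtain ⟨n, hn⟩ := exists_nat_gt ((u : ℝ) / min δ₁ δ₂)
  have hδ : 0 < min δ₁ δ₂ := lt_min hδ₁ hδ₂
  have hn0 : (0 : ℝ) < n := lt_of_le_of_lt (by positivity) hn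
  have hn1 : (n : ℝ≥0) ≠ 0 := by
    have : n ≠ 0 := by rintro rfl; simp at hn0
    exact_mod_cast this
  have hmesh : (u : ℝ) / n < min δ₁ δ₂ := by
    rw [div_lt_iff₀ hδ] at hn
    rw [div_lt_iff₀ hn0]; linarith
  -- This subdivision has `n` equal steps on `[0, t]` and `n` more on `[t, u]`; `min` and truncated
  -- subtraction glue the two pieces. As `t` is a node, the sums up to `t` and up to `u` differ by a
  -- Riemann sum over `[t, u]`.
  set s : ℕ → ℝ≥0 := fun j => t * ((min j n : ℕ) : ℝ≥0) / n + (u - t) * ((j - n : ℕ) : ℝ≥0) / n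
    with hs
  have hmono : Monotone s := by
    intro i j hij
    simp only [hs]
    gcongr
  have hs0 : s 0 = 0 := by simp [hs]
  have hsn : s n = t := by simp [hs, hn1]
  have hs2n : s (n + n) = u := by
    simp only [hs, Nat.le_add_right, inf_of_le_right, Nat.add_sub_cancel,
      mul_div_cancel_right₀ _ hn1]
    exact add_tsub_cancel_of_le htu
  have hstep : ∀ j, (s (j + 1) : ℝ) - (s j : ℝ) < min δ₁ δ₂ := by
    intro j
    refine lt_of_le_of_lt ?_ hmesh
    have htu' : (t : ℝ) ≤ u := by exact_mod_cast htu
    simp only [hs, NNReal.coe_add, NNReal.coe_div, NNReal.coe_mul, NNReal.coe_natCast,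
      NNReal.coe_sub htu]
    rcases lt_or_ge j n with hj | hj
    · rw [min_eq_left hj.le, min_eq_left (show j + 1 ≤ n from hj),
        Nat.sub_eq_zero_of_le hj.le, Nat.sub_eq_zero_of_le (show j + 1 ≤ n from hj)]
      push_cast
      rw [← sub_nonneg]
      have : (u : ℝ) / n - (t * (j + 1) / n + (u - t) * 0 / n - (t * j / n + (u - t) * 0 / n))
        = (u - t) / n := by ring
      rw [this]
      exact div_nonneg (by linarith) hn0.le
    · rw [min_eq_right hj, min_eq_right (show n ≤ j + 1 by omega), Nat.succ_sub hj]
      push_cast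
      rw [← sub_nonneg]
      have : (u : ℝ) / n - (t * n / n + (u - t) * ((j - n : ℕ) + 1) / n
          - (t * n / n + (u - t) * (j - n : ℕ) / n)) = t / n := by ring
      rw [this]
      positivity
  have b₁ := h₁ n s hmono hs0 hsn fun j _ => (hstep j).trans_le (min_le_left _ _)
  have b₂ := h₂ (n + n) s hmono hs0 hs2n fun j _ => (hstep j).trans_le (min_le_right _ _)
  refine ⟨_, ⟨n, fun j => s (n + j), fun i j hij => hmono (by omega), hsn, hs2n, rfl⟩, ?_⟩
  rw [Finset.sum_range_add] at b₂
  rw [dist_eq_norm, itoSum]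
  set a := ∑ j ∈ Finset.range n, Y (s j) * (X (s (j + 1)) - X (s j))
  set b := ∑ x ∈ Finset.range n, Y (s (n + x)) * (X (s (n + x + 1)) - X (s (n + x)))
  have : K - J - b = (a - J) - (a + b - K) := by abel
  calc ‖K - J - b‖ = ‖(a - J) - (a + b - K)‖ := by rw [this]
    _ ≤ ‖a - J‖ + ‖a + b - K‖ := norm_sub_le _ _
    _ < ε := by linarith

variable {t u : ℝ≥0} {J K : A}

theorem HasFreeItoIntegral.apply_mul_sub (hX : IsFreeBrownianMotion τ F X)
    (hτ : IsTracialState τ) (hY : ∀ t, Y t ∈ F t) (htu : t ≤ u)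
    (hJ : HasFreeItoIntegral Y X t J) (hK : HasFreeItoIntegral Y X u K)
    {a : A} (ha : a ∈ F t) : τ (a * (K - J)) = 0 := by
  have hc : IsClosed {S : A | τ (a * S) = 0} :=
    isClosed_eq (hτ.continuous.comp (by fun_prop)) continuous_const
  refine closure_minimal ?_ hc (hJ.sub_mem_closure htu hK)
  rintro _ ⟨N, s, hs, h0, hN, rfl⟩
  rw [Set.mem_ofPred_eq, mul_itoSum]
  exact hX.apply_itoSum hτ hs
    (fun j => mul_mem (hX.filtration_mono (h0 ▸ hs (Nat.zero_le j)) ha) (hY _)) N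

theorem HasFreeItoIntegral.apply_star_sub_mul_sub (hX : IsFreeBrownianMotion τ F X)
    (hτ : IsTracialState τ) (hY : ∀ t, Y t ∈ F t) (hu : ∀ t, Y t ∈ unitary A) (htu : t ≤ u)
    (hJ : HasFreeItoIntegral Y X t J) (hK : HasFreeItoIntegral Y X u K) :
    τ (star (K - J) * (K - J)) = ((u : ℝ) : ℂ) - ((t : ℝ) : ℂ) := by
  have hc : IsClosed {S : A | τ (star S * S) = ((u : ℝ) : ℂ) - ((t : ℝ) : ℂ)} :=
    isClosed_eq (hτ.continuous.comp (by fun_prop)) continuous_const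
  refine closure_minimal ?_ hc (hJ.sub_mem_closure htu hK)
  rintro _ ⟨N, s, hs, h0, hN, rfl⟩
  rw [Set.mem_ofPred_eq, hX.apply_star_itoSum_mul_itoSum hτ hs (fun j => hY _) (fun j => hu _),
    h0, hN]

/-- On Riemann sums the left side is exactly a sum of `τ(a Y) τ(b Y) Δs`. Freezing the integrand at
`c` costs `C` per unit length, and a non-strict bound survives the norm limit. -/
theorem HasFreeItoIntegral.norm_apply_mul_sub_mul_mul_sub (hX : IsFreeBrownianMotion τ F X)
    (hτ : IsTracialState τ) (hY : ∀ t, Y t ∈ F t) (htu : t ≤ u)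
    (hJ : HasFreeItoIntegral Y X t J) (hK : HasFreeItoIntegral Y X u K)
    {a b : A} (ha : a ∈ F t) (hb : b ∈ F t) {c : ℂ} {C : ℝ}
    (hC : ∀ s, t ≤ s → s ≤ u → ‖τ (a * Y s) * τ (b * Y s) - c‖ ≤ C) :
    ‖τ (a * (K - J) * (b * (K - J))) - c * (((u : ℝ) : ℂ) - ((t : ℝ) : ℂ))‖
      ≤ C * ((u : ℝ) - t) := by
  have hc : IsClosed {S : A | ‖τ (a * S * (b * S)) - c * (((u : ℝ) : ℂ) - ((t : ℝ) : ℂ))‖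
      ≤ C * ((u : ℝ) - t)} :=
    isClosed_le (((hτ.continuous.comp (by fun_prop)).sub continuous_const).norm) continuous_const
  refine closure_minimal ?_ hc (hJ.sub_mem_closure htu hK)
  rintro _ ⟨N, s, hs, h0, hN, rfl⟩
  have hmem : ∀ {x : A}, x ∈ F t → ∀ j, x * Y (s j) ∈ F (s j) := fun hx j =>
    mul_mem (hX.filtration_mono (h0 ▸ hs (Nat.zero_le j)) hx) (hY _)
  rw [Set.mem_ofPred_eq, mul_itoSum, mul_itoSum,
    hX.apply_itoSum_mul_itoSum hτ hs (hmem ha) (hmem hb)]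
  have e1 : ((u : ℝ) : ℂ) - ((t : ℝ) : ℂ) =
      ∑ j ∈ Finset.range N, (((s (j + 1) : ℝ) : ℂ) - ((s j : ℝ) : ℂ)) := by
    rw [Finset.sum_range_sub (fun j => ((s j : ℝ) : ℂ)), h0, hN]
  have e2 : (u : ℝ) - t = ∑ j ∈ Finset.range N, ((s (j + 1) : ℝ) - s j) := by
    rw [Finset.sum_range_sub (fun j => (s j : ℝ)), h0, hN]
  rw [e1, e2, Finset.mul_sum, Finset.mul_sum, ← Finset.sum_sub_distrib]
  refine norm_sum_le_of_le _ fun j hj => ?_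
  have hj' : j < N := Finset.mem_range.mp hj
  have hle : (s j : ℝ) ≤ s (j + 1) := by exact_mod_cast hs (Nat.le_succ j)
  rw [← sub_mul, norm_mul, ← Complex.ofReal_sub, Complex.norm_of_nonneg (by linarith)]
  exact mul_le_mul_of_nonneg_right
    (hC _ (h0 ▸ hs (Nat.zero_le j)) (hN ▸ hs hj'.le)) (by linarith)

end Ito

end ItoIntegral

/-! ### First-order expansion of the moments over a short interval -/

section SmallIncrement

variable {A : Type*} [CStarAlgebra A]

theorem pow_sub_pow_eq_sum {R : Type*} [Ring R] (U V : R) (n : ℕ) :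
    U ^ n - V ^ n = ∑ i ∈ Finset.range n, U ^ i * (U - V) * V ^ (n - 1 - i) := by
  induction n with
  | zero => simp
  | succ n ih =>
    have h : U ^ (n + 1) - V ^ (n + 1) = (U ^ n - V ^ n) * V + U ^ n * (U - V) := by
      rw [pow_succ, pow_succ]; noncomm_ring
    rw [h, ih, Finset.sum_range_succ, Finset.sum_mul]
    congr 1
    · refine Finset.sum_congr rfl fun i hi => ?_
      have hi' := Finset.mem_range.mp hi
      rw [mul_assoc, ← pow_succ, show n - 1 - i + 1 = n + 1 - 1 - i by omega]
    · simp

theorem norm_pow_sub_pow_le {R : Type*} [NormedRing R] [NormOneClass R] {U V : R} (hU : ‖U‖ ≤ 1)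
    (hV : ‖V‖ ≤ 1) (n : ℕ) : ‖U ^ n - V ^ n‖ ≤ n * ‖U - V‖ := by
  rw [pow_sub_pow_eq_sum]
  have hc : (n : ℝ) * ‖U - V‖ = ∑ _i ∈ Finset.range n, ‖U - V‖ := by
    rw [Finset.sum_const, Finset.card_range, nsmul_eq_mul]
  rw [hc]
  refine norm_sum_le_of_le _ fun i _ => ?_
  have h1 : ‖U ^ i‖ ≤ 1 := (norm_pow_le U i).trans (pow_le_one₀ (norm_nonneg U) hU)
  have h2 : ‖V ^ (n - 1 - i)‖ ≤ 1 := (norm_pow_le V _).trans (pow_le_one₀ (norm_nonneg V) hV)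
  calc _ ≤ ‖U ^ i‖ * ‖U - V‖ * ‖V ^ (n - 1 - i)‖ := norm_mul₃_le
    _ ≤ 1 * ‖U - V‖ * 1 := by gcongr
    _ = ‖U - V‖ := by ring

/-- A sum over pairs whose terms depend on the difference only, symmetrically. -/
theorem sum_range_sum_range_sub_eq {g : ℕ → ℂ} (n : ℕ) (hg : ∀ p ≤ n, g (n - p) = g p) :
    ∑ i ∈ Finset.range n, ∑ j ∈ Finset.range i, g (i - j) =
      (n : ℂ) / 2 * ∑ p ∈ Finset.Ico 1 n, g p := by
  have hA : ∀ i, ∑ j ∈ Finset.range i, g (i - j) = ∑ p ∈ Finset.Ico 1 (i + 1), g p := by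
    intro i
    rw [Finset.sum_Ico_eq_sum_range, ← Finset.sum_range_reflect]
    refine Finset.sum_congr (by simp) fun j hj => ?_
    have := Finset.mem_range.mp hj
    congr 1; omega
  -- The inner sums for `i` and `n - 1 - i` complement each other under `p ↦ n - p`, so that
  -- together they give the full sum.
  have hpair : ∀ i ∈ Finset.range n, ∑ p ∈ Finset.Ico 1 (i + 1), g p
      + ∑ p ∈ Finset.Ico 1 (n - 1 - i + 1), g p = ∑ p ∈ Finset.Ico 1 n, g p := by
    intro i hi
    have hi' := Finset.mem_range.mp hi
    rw [← Finset.sum_Ico_consecutive g (show 1 ≤ i + 1 by omega) (show i + 1 ≤ n by omega)]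
    congr 1
    refine Finset.sum_nbij' (fun p => n - p) (fun p => n - p) ?_ ?_ ?_ ?_ ?_
    · intro p hp; simp only [Finset.mem_Ico] at hp ⊢; omega
    · intro p hp; simp only [Finset.mem_Ico] at hp ⊢; omega
    · intro p hp; simp only [Finset.mem_Ico] at hp; omega
    · intro p hp; simp only [Finset.mem_Ico] at hp; omega
    · intro p hp; simp only [Finset.mem_Ico] at hp; exact (hg p (by omega)).symm
  have h2 := Finset.sum_congr rfl hpair
  rw [Finset.sum_add_distrib,
    Finset.sum_range_reflect (fun i => ∑ p ∈ Finset.Ico 1 (i + 1), g p) n] at h2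
  rw [Finset.sum_congr rfl fun i _ => hA i]
  simp only [Finset.sum_const, Finset.card_range, nsmul_eq_mul] at h2
  linear_combination h2 / 2

/-- The properties of an increment `D = i K + R` of a free unitary Brownian motion, over an interval
of length `h`, which determine the moments to first order in `h`. -/
structure IsSmallIncrement (τ : A →ₗ[ℂ] ℂ) (S : StarSubalgebra ℂ A) (V D K : A) (h ε : ℝ) :
    Prop where
  h_nonneg : 0 ≤ h
  h_le : h ≤ ε
  eps_le : ε ≤ 1
  norm_increment_le : ‖D‖ ≤ ε
  norm_drift_le : ‖D - Complex.I • K + ((h / 2 : ℝ) : ℂ) • V‖ ≤ h * ε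
  norm_le : ‖V‖ ≤ 1
  apply_mul : ∀ a ∈ S, τ (a * K) = 0
  norm_quadratic_le : ∀ x y, ‖τ (x * K * (y * K))‖ ≤ ‖x‖ * ‖y‖ * h
  norm_quadratic_sub_le : ∀ a ∈ S, ∀ b ∈ S, ‖a‖ ≤ 1 → ‖b‖ ≤ 1 →
    ‖τ (a * K * (b * K)) - τ (a * V) * τ (b * V) * h‖ ≤ 2 * ε * h

namespace IsSmallIncrement

variable {τ : A →ₗ[ℂ] ℂ} {S : StarSubalgebra ℂ A} {V D K : A} {h ε : ℝ}

theorem norm_remainder_le (H : IsSmallIncrement τ S V D K h ε) : ‖D - Complex.I • K‖ ≤ 2 * h := by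
  have h0 := H.h_nonneg
  have e1 : ‖((h / 2 : ℝ) : ℂ) • V‖ ≤ h := by
    rw [norm_smul, Complex.norm_of_nonneg (by linarith)]
    nlinarith [H.norm_le, norm_nonneg V]
  have e2 : D - Complex.I • K =
      (D - Complex.I • K + ((h / 2 : ℝ) : ℂ) • V) - ((h / 2 : ℝ) : ℂ) • V := by abel
  rw [e2]
  refine (norm_sub_le _ _).trans ?_
  nlinarith [H.norm_drift_le, H.eps_le]

theorem norm_martingale_le (H : IsSmallIncrement τ S V D K h ε) : ‖K‖ ≤ 3 * ε := by
  have e : ‖K‖ = ‖Complex.I • K‖ := by rw [norm_smul, Complex.norm_I, one_mul]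
  have e2 : Complex.I • K = D - (D - Complex.I • K) := by abel
  rw [e, e2]
  refine (norm_sub_le _ _).trans ?_
  linarith [H.norm_remainder_le, H.norm_increment_le, H.h_le]

theorem norm_first_order_le (H : IsSmallIncrement τ S V D K h ε) (hτ : IsTracialState τ)
    {a : A} (ha : a ∈ S) (ha1 : ‖a‖ ≤ 1) : ‖τ (a * D) + (h / 2 : ℝ) * τ (a * V)‖ ≤ h * ε := by
  have e : τ (a * D) + (h / 2 : ℝ) * τ (a * V)
      = τ (a * (D - Complex.I • K + ((h / 2 : ℝ) : ℂ) • V)) := by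
    simp only [mul_add, mul_sub, mul_smul_comm, map_add, map_sub, map_smul, H.apply_mul a ha,
      smul_eq_mul]
    ring
  rw [e]
  refine (hτ.norm_apply_le _).trans ((norm_mul_le _ _).trans ?_)
  calc _ ≤ 1 * (h * ε) := mul_le_mul ha1 H.norm_drift_le (norm_nonneg _) zero_le_one
    _ = h * ε := one_mul _

/-- In norm `K` is only `O(ε)`, but the remainder `R = D - iK` is `O(h)`; every term except
`(iK)(iK)` is thus `O(εh)`. -/
theorem norm_second_order_add_le (H : IsSmallIncrement τ S V D K h ε) (hτ : IsTracialState τ)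
    (x y : A) : ‖τ (x * D * (y * D)) + τ (x * K * (y * K))‖ ≤ ‖x‖ * ‖y‖ * (16 * ε * h) := by
  set R := D - Complex.I • K with hR
  have hD : D = Complex.I • K + R := by rw [hR]; abel
  have e : τ (x * D * (y * D)) + τ (x * K * (y * K)) =
      Complex.I * τ (x * K * (y * R)) + Complex.I * τ (x * R * (y * K)) + τ (x * R * (y * R)) := by
    rw [hD]
    simp only [mul_add, add_mul, mul_smul_comm, smul_mul_assoc, map_add, map_smul, smul_eq_mul]
    linear_combination (τ (x * K * (y * K))) * Complex.I_mul_I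
  have hbd : ∀ p q : A, ‖τ (x * p * (y * q))‖ ≤ ‖x‖ * ‖y‖ * (‖p‖ * ‖q‖) := by
    intro p q
    refine (hτ.norm_apply_le _).trans ((norm_mul_le _ _).trans ?_)
    calc _ ≤ (‖x‖ * ‖p‖) * (‖y‖ * ‖q‖) := by gcongr <;> exact norm_mul_le _ _
      _ = _ := by ring
  have hK := H.norm_martingale_le
  have hRn := H.norm_remainder_le
  have h0 := H.h_nonneg
  have hε := h0.trans H.h_le
  rw [e]
  refine (norm_add₃_le).trans ?_
  rw [norm_mul, norm_mul, Complex.norm_I, one_mul, one_mul]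
  -- Two cross terms of size `6εh` and one remainder term of size `4εh` make up the constant `16`.
  have b1 : ‖K‖ * ‖R‖ ≤ 3 * ε * (2 * h) := by gcongr
  have b2 : ‖R‖ * ‖R‖ ≤ 2 * ε * (2 * h) := by
    have := H.h_le
    gcongr
    linarith
  have hxy : 0 ≤ ‖x‖ * ‖y‖ := by positivity
  calc _ ≤ ‖x‖ * ‖y‖ * (‖K‖ * ‖R‖) + ‖x‖ * ‖y‖ * (‖R‖ * ‖K‖) + ‖x‖ * ‖y‖ * (‖R‖ * ‖R‖) := by
        gcongr <;> exact hbd _ _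
    _ = ‖x‖ * ‖y‖ * (2 * (‖K‖ * ‖R‖) + ‖R‖ * ‖R‖) := by ring
    _ ≤ _ := by gcongr; linarith

/-- No adaptedness is asked of `x` and `y`: this controls the error terms whose coefficients involve
`U = V + D`. -/
theorem norm_second_order_le (H : IsSmallIncrement τ S V D K h ε) (hτ : IsTracialState τ)
    (x y : A) : ‖τ (x * D * (y * D))‖ ≤ ‖x‖ * ‖y‖ * (17 * h) := by
  have e : τ (x * D * (y * D)) =
    (τ (x * D * (y * D)) + τ (x * K * (y * K))) - τ (x * K * (y * K)) := by ring
  rw [e]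
  refine (norm_sub_le _ _).trans ?_
  have h1 := H.norm_second_order_add_le hτ x y
  have h2 := H.norm_quadratic_le x y
  have hxy : 0 ≤ ‖x‖ * ‖y‖ := by positivity
  have : 16 * ε * h ≤ 16 * h := by nlinarith [H.h_nonneg, H.eps_le]
  nlinarith

theorem norm_second_order_sub_le (H : IsSmallIncrement τ S V D K h ε) (hτ : IsTracialState τ)
    {a b : A} (ha : a ∈ S) (hb : b ∈ S) (ha1 : ‖a‖ ≤ 1) (hb1 : ‖b‖ ≤ 1) :
    ‖τ (a * D * (b * D)) + h * (τ (a * V) * τ (b * V))‖ ≤ 18 * ε * h := by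
  have e : τ (a * D * (b * D)) + h * (τ (a * V) * τ (b * V)) =
    (τ (a * D * (b * D)) + τ (a * K * (b * K)))
      - (τ (a * K * (b * K)) - τ (a * V) * τ (b * V) * h) := by ring
  rw [e]
  refine (norm_sub_le _ _).trans ?_
  have h1 := H.norm_second_order_add_le hτ a b
  have h2 := H.norm_quadratic_sub_le a ha b hb ha1 hb1
  have h3 : ‖a‖ * ‖b‖ ≤ 1 := mul_le_one₀ ha1 (norm_nonneg _) hb1
  have h4 : 0 ≤ 16 * ε * h := mul_nonneg (by linarith [H.h_nonneg, H.h_le]) H.h_nonneg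
  nlinarith

/-- The first order expansion of the moments. -/
theorem norm_apply_pow_sub_le [NormOneClass A] (H : IsSmallIncrement τ S V D K h ε)
    (hτ : IsTracialState τ) (hV : V ∈ S) (hU1 : ‖V + D‖ ≤ 1) (n : ℕ) :
    ‖τ ((V + D) ^ n) - τ (V ^ n) + h * ((n / 2 : ℝ) * τ (V ^ n) +
      ∑ i ∈ Finset.range n, ∑ j ∈ Finset.range i, τ (V ^ (n - (i - j))) * τ (V ^ (i - j)))‖
        ≤ n * (1 + n * (18 + 17 * n)) * ε * h := by
  have h0 := H.h_nonneg
  have hε := h0.trans H.h_le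
  set U := V + D with hU
  have hUV : U - V = D := by rw [hU]; abel
  have hV1 := H.norm_le
  have hVp : ∀ k, ‖V ^ k‖ ≤ 1 := fun k => (norm_pow_le V k).trans (pow_le_one₀ (norm_nonneg V) hV1)
  have hVm : ∀ k, V ^ k ∈ S := fun k => pow_mem hV k
  have hterm : ∀ i ∈ Finset.range n, ∀ j ∈ Finset.range i,
      ‖τ (V ^ (n - 1 - i) * U ^ j * D * (V ^ (i - 1 - j) * D))
        + h * (τ (V ^ (n - (i - j))) * τ (V ^ (i - j)))‖ ≤ (18 + 17 * n) * ε * h := by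
    intro i hi j hj
    have hi' := Finset.mem_range.mp hi
    have hj' := Finset.mem_range.mp hj
    have e1 := H.norm_second_order_sub_le hτ (hVm (n - 1 - i + j)) (hVm (i - 1 - j))
      (hVp _) (hVp _)
    rw [← pow_succ, ← pow_succ, show n - 1 - i + j + 1 = n - (i - j) by omega,
      show i - 1 - j + 1 = i - j by omega] at e1
    have e2 := H.norm_second_order_le hτ (V ^ (n - 1 - i) * (U ^ j - V ^ j)) (V ^ (i - 1 - j))
    have e3 : ‖V ^ (n - 1 - i) * (U ^ j - V ^ j)‖ ≤ n * ε := by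
      refine (norm_mul_le _ _).trans ?_
      have h5 := norm_pow_sub_pow_le hU1 hV1 j
      rw [hUV] at h5
      have hjn : (j : ℝ) ≤ n := by exact_mod_cast (hj'.trans hi').le
      calc _ ≤ 1 * (n * ε) := by
            gcongr
            · exact hVp _
            · exact h5.trans (by gcongr; exact H.norm_increment_le)
        _ = _ := one_mul _
    -- Replacing `U ^ j` by `V ^ j` puts the coefficient in `S`; the difference is `O(nε)` and meets
    -- the crude bound `17 h`.
    have e4 : V ^ (n - 1 - i) * U ^ j =
        V ^ (n - 1 - i + j) + V ^ (n - 1 - i) * (U ^ j - V ^ j) := by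
      rw [mul_sub, pow_add]; abel
    rw [e4, add_mul, add_mul, map_add, add_right_comm]
    refine (norm_add_le _ _).trans ?_
    have e5 : ‖V ^ (n - 1 - i) * (U ^ j - V ^ j)‖ * ‖V ^ (i - 1 - j)‖ * (17 * h) ≤
        n * ε * 1 * (17 * h) := by
      gcongr
      exact hVp _
    linarith
  have houter : ∀ i ∈ Finset.range n,
      ‖τ (U ^ i * D * V ^ (n - 1 - i)) + ((h / 2 : ℝ) * τ (V ^ n) +
        ∑ j ∈ Finset.range i, h * (τ (V ^ (n - (i - j))) * τ (V ^ (i - j))))‖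
        ≤ h * ε + n * ((18 + 17 * n) * ε * h) := by
    intro i hi
    have hi' := Finset.mem_range.mp hi
    -- A second telescoping, now of `U ^ i`, separates the first-order term in `V` from the terms
    -- quadratic in `D`.
    have e1 : τ (U ^ i * D * V ^ (n - 1 - i)) = τ (V ^ (n - 1) * D) +
        ∑ j ∈ Finset.range i, τ (V ^ (n - 1 - i) * U ^ j * D * (V ^ (i - 1 - j) * D)) := by
      have h5 : U ^ i = V ^ i + ∑ j ∈ Finset.range i, U ^ j * D * V ^ (i - 1 - j) := by
        have := pow_sub_pow_eq_sum U V i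
        rw [hUV] at this
        rw [← this]; abel
      rw [hτ.trace]
      conv_lhs => rw [h5]
      rw [add_mul, mul_add, map_add, ← mul_assoc, ← pow_add, show n - 1 - i + i = n - 1 by omega,
        Finset.sum_mul, Finset.mul_sum, map_sum]
      simp only [mul_assoc]
    have e2 := H.norm_first_order_le hτ (hVm (n - 1)) (hVp _)
    rw [← pow_succ, show n - 1 + 1 = n by omega] at e2
    rw [e1, add_add_add_comm, ← Finset.sum_add_distrib]
    refine (norm_add_le _ _).trans (add_le_add e2 ?_)
    refine (norm_sum_le_of_le _ (hterm i hi)).trans ?_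
    rw [Finset.sum_const, Finset.card_range, nsmul_eq_mul]
    have : (i : ℝ) ≤ n := by exact_mod_cast hi'.le
    gcongr
  have hfin : τ (U ^ n) - τ (V ^ n) + h * ((n / 2 : ℝ) * τ (V ^ n) +
      ∑ i ∈ Finset.range n, ∑ j ∈ Finset.range i, τ (V ^ (n - (i - j))) * τ (V ^ (i - j))) =
      ∑ i ∈ Finset.range n, (τ (U ^ i * D * V ^ (n - 1 - i)) + ((h / 2 : ℝ) * τ (V ^ n) +
        ∑ j ∈ Finset.range i, h * (τ (V ^ (n - (i - j))) * τ (V ^ (i - j))))) := by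
    rw [← map_sub, pow_sub_pow_eq_sum, hUV, map_sum, Finset.sum_add_distrib,
      Finset.sum_add_distrib, Finset.sum_const, Finset.card_range, nsmul_eq_mul, mul_add,
      Finset.mul_sum]
    simp only [Finset.mul_sum]
    push_cast
    ring
  rw [hfin]
  refine (norm_sum_le_of_le _ houter).trans ?_
  rw [Finset.sum_const, Finset.card_range, nsmul_eq_mul]
  apply le_of_eq
  ring

end IsSmallIncrement

end SmallIncrement

/-! ### Differential equations for the moments -/

section MomentEquation

variable {A : Type*} [CStarAlgebra A]

theorem IsTracialState.normOneClass {τ : A →ₗ[ℂ] ℂ} (hτ : IsTracialState τ) : NormOneClass A := by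
  have : Nontrivial A := ⟨1, 0, fun h => by simpa [h] using hτ.map_one⟩
  infer_instance

theorem norm_le_one_of_mem_unitary [NormOneClass A] {U : A} (hU : U ∈ unitary A) : ‖U‖ ≤ 1 := by
  have : Nontrivial A := NormOneClass.nontrivial (G := A)
  exact (CStarRing.norm_of_mem_unitary hU).le

variable {τ : A →ₗ[ℂ] ℂ} {Y : ℝ≥0 → A}

namespace IsFreeUnitaryBrownianMotion

theorem apply_zero (hY : IsFreeUnitaryBrownianMotion τ Y) : Y 0 = 1 := by
  obtain ⟨F, X, hX, hYF, h⟩ := hY.sde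
  obtain ⟨J, hJ, e⟩ := h 0
  have hJ0 : J = 0 := by
    by_contra hne
    obtain ⟨δ, hδ, hs⟩ := hJ ‖J‖ (norm_pos_iff.mpr hne)
    -- The empty subdivision has sum `0`, which would give `‖J‖ < ‖J‖`.
    have := hs 0 (fun _ => 0) monotone_const rfl rfl (by simp)
    simp at this
  simpa [hJ0] using e

/-- The witness is the increment of the Itô integral over `[t, u]`. The drift error is `-½ ∫ (Y_s -
Y_t) ds`, and freezing `τ(a Y_s) τ(b Y_s)` at `s = t` costs `2ε`. -/
theorem exists_isSmallIncrement (hY : IsFreeUnitaryBrownianMotion τ Y) (hτ : IsTracialState τ)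
    (t : ℝ≥0) : ∃ S : StarSubalgebra ℂ A, Y t ∈ S ∧ ∀ (u : ℝ≥0) (ε : ℝ), t ≤ u → (u : ℝ) - t ≤ ε →
      ε ≤ 1 → (∀ s, t ≤ s → s ≤ u → ‖Y s - Y t‖ ≤ ε) →
        ∃ K : A, IsSmallIncrement τ S (Y t) (Y u - Y t) K ((u : ℝ) - t) ε := by
  have := hτ.normOneClass
  obtain ⟨F, X, hX, hYF, h⟩ := hY.sde
  refine ⟨F t, hYF t, fun u ε htu hε hε1 hs => ?_⟩
  obtain ⟨J, hJ, eJ⟩ := h t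
  obtain ⟨K, hK, eK⟩ := h u
  have htu' : (t : ℝ) ≤ u := by exact_mod_cast htu
  have hV1 := norm_le_one_of_mem_unitary (hY.unitary t)
  have hcont : Continuous fun s : ℝ => Y s.toNNReal := hY.continuous.comp continuous_real_toNNReal
  refine ⟨K - J, by linarith, hε, hε1, hs u htu le_rfl, ?_, hV1, ?_, ?_, ?_⟩
  · have e : Y u - Y t - Complex.I • (K - J) + ((((u : ℝ) - t) / 2 : ℝ) : ℂ) • Y t =
        -((1 / 2 : ℂ) • ∫ s in (t : ℝ)..u, (Y s.toNNReal - Y t)) := by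
      rw [intervalIntegral.integral_sub (hcont.intervalIntegrable _ _)
        (continuous_const.intervalIntegrable _ _), intervalIntegral.integral_const,
        ← intervalIntegral.integral_interval_sub_left (hcont.intervalIntegrable 0 _)
          (hcont.intervalIntegrable 0 _), eJ, eK, ← Complex.coe_smul]
      push_cast
      module
    rw [e, norm_neg, norm_smul]
    have hb : ‖∫ s in (t : ℝ)..u, (Y s.toNNReal - Y t)‖ ≤ ε * |(u : ℝ) - t| := by
      refine intervalIntegral.norm_integral_le_of_norm_le_const fun s hs' => ?_
      rw [Set.uIoc_of_le htu'] at hs'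
      exact hs _ (NNReal.le_toNNReal_of_coe_le hs'.1.le) (Real.toNNReal_le_iff_le_coe.mpr hs'.2)
    rw [abs_of_nonneg (by linarith)] at hb
    have h12 : ‖(1 / 2 : ℂ)‖ = 1 / 2 := by norm_num
    rw [h12]
    nlinarith [norm_nonneg (∫ s in (t : ℝ)..u, (Y s.toNNReal - Y t))]
  · exact fun a ha => hJ.apply_mul_sub hX hτ hYF htu hK ha
  · intro x y
    have h1 := hτ.norm_apply_mul_mul_le x y (K - J)
    rw [hJ.apply_star_sub_mul_sub hX hτ hYF hY.unitary htu hK, ← Complex.ofReal_sub,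
      Complex.ofReal_re] at h1
    exact h1
  · intro a ha b hb ha1 hb1
    rw [Complex.ofReal_sub]
    refine hJ.norm_apply_mul_sub_mul_mul_sub hX hτ hYF htu hK ha hb fun s hts hsu => ?_
    have hd : ∀ c : A, ‖c‖ ≤ 1 → ‖τ (c * Y s) - τ (c * Y t)‖ ≤ ε := by
      intro c hc
      rw [← map_sub, ← mul_sub]
      refine (hτ.norm_apply_le _).trans ((norm_mul_le _ _).trans ?_)
      nlinarith [hs s hts hsu, norm_nonneg c, norm_nonneg (Y s - Y t)]
    have hn : ∀ (c : A) (r : ℝ≥0), ‖c‖ ≤ 1 → ‖τ (c * Y r)‖ ≤ 1 := fun c r hc =>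
      (hτ.norm_apply_le _).trans ((norm_mul_le _ _).trans
        (mul_le_one₀ hc (norm_nonneg _) (norm_le_one_of_mem_unitary (hY.unitary r))))
    have e : τ (a * Y s) * τ (b * Y s) - τ (a * Y t) * τ (b * Y t) =
        (τ (a * Y s) - τ (a * Y t)) * τ (b * Y s) + τ (a * Y t) * (τ (b * Y s) - τ (b * Y t)) := by
      ring
    rw [e]
    refine (norm_add_le _ _).trans ?_
    rw [norm_mul, norm_mul]
    have h1 := hd a ha1
    have h2 := hd b hb1
    have h3 := hn b s hb1
    have h4 := hn a t ha1
    nlinarith [norm_nonneg (τ (a * Y s) - τ (a * Y t)), norm_nonneg (τ (b * Y s) - τ (b * Y t)),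
      norm_nonneg (τ (b * Y s)), norm_nonneg (τ (a * Y t))]

/-- Freeness concerns increments after `t`, whence a right derivative; with continuity this suffices
for uniqueness. -/
theorem hasDerivWithinAt_apply_pow (hY : IsFreeUnitaryBrownianMotion τ Y) (hτ : IsTracialState τ)
    (n : ℕ) (t : ℝ≥0) :
    HasDerivWithinAt (fun x : ℝ => τ (Y x.toNNReal ^ n))
      (-((n / 2 : ℝ) * τ (Y t ^ n) +
        (n : ℂ) / 2 * ∑ p ∈ Finset.Ico 1 n, τ (Y t ^ p) * τ (Y t ^ (n - p))))
      (Set.Ici (t : ℝ)) (t : ℝ) := by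
  have := hτ.normOneClass
  obtain ⟨S, hS, H⟩ := hY.exists_isSmallIncrement hτ t
  have hsum : (n : ℂ) / 2 * ∑ p ∈ Finset.Ico 1 n, τ (Y t ^ p) * τ (Y t ^ (n - p)) =
      ∑ i ∈ Finset.range n, ∑ j ∈ Finset.range i,
        τ (Y t ^ (n - (i - j))) * τ (Y t ^ (i - j)) := by
    rw [← sum_range_sum_range_sub_eq (g := fun p => τ (Y t ^ p) * τ (Y t ^ (n - p))) n]
    · simp only [mul_comm]
    · intro p hp
      simp only [Nat.sub_sub_self hp, mul_comm]
  rw [hsum, hasDerivWithinAt_iff_isLittleO, Asymptotics.isLittleO_iff]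
  intro c hc
  set C : ℝ := n * (1 + n * (18 + 17 * n)) with hC
  have hC0 : 0 ≤ C := by positivity
  -- The choice ensures `C ε ≤ c`; `C + 1` guards against `C = 0`, which occurs for `n = 0`.
  set ε : ℝ := min 1 (c / (C + 1)) with hε
  have hε0 : 0 < ε := by positivity
  have hCε : C * ε ≤ c := by
    calc C * ε ≤ (C + 1) * (c / (C + 1)) := by
          gcongr
          · linarith
          · exact min_le_right _ _
      _ = c := by field_simp
  obtain ⟨δ, hδ, hYδ⟩ := Metric.continuous_iff.mp hY.continuous t ε hε0
  have hmem : Set.Ico (t : ℝ) (t + min δ ε) ∈ nhdsWithin (t : ℝ) (Set.Ici (t : ℝ)) :=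
    Ico_mem_nhdsGE (by have := lt_min hδ hε0; linarith)
  filter_upwards [hmem] with x hx
  have hx0 : 0 ≤ x := t.coe_nonneg.trans hx.1
  lift x to ℝ≥0 using hx0
  have htx : t ≤ x := by exact_mod_cast hx.1
  have hxδ := min_le_left δ ε
  have hxε := min_le_right δ ε
  obtain ⟨K, hK⟩ := H x ε htx (by linarith [hx.2]) (min_le_left _ _) fun s hts hsx => by
    rw [← dist_eq_norm]
    refine (hYδ s ?_).le
    have h1 : (t : ℝ) ≤ s := by exact_mod_cast hts
    have h2 : (s : ℝ) ≤ x := by exact_mod_cast hsx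
    rw [NNReal.dist_eq, abs_of_nonneg (by linarith)]
    linarith [hx.2]
  have hfin := hK.norm_apply_pow_sub_le hτ hS
    (by rw [add_sub_cancel]; exact norm_le_one_of_mem_unitary (hY.unitary x)) n
  rw [add_sub_cancel] at hfin
  rw [Real.toNNReal_coe, Real.toNNReal_coe, smul_neg, sub_neg_eq_add, Complex.real_smul,
    Real.norm_of_nonneg (by linarith [hx.1])]
  refine hfin.trans ?_
  have : 0 ≤ (x : ℝ) - t := by linarith [hx.1]
  nlinarith

/-- The differential equations satisfied by the normalized moments. -/
theorem hasDerivWithinAt_momentQ (hY : IsFreeUnitaryBrownianMotion τ Y) (hτ : IsTracialState τ)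
    (n : ℕ) (t : ℝ≥0) :
    HasDerivWithinAt (fun x : ℝ => momentQ τ Y n x.toNNReal)
      (-((n : ℂ) / 2 * ∑ p ∈ Finset.Ico 1 n, momentQ τ Y p t * momentQ τ Y (n - p) t))
      (Set.Ici (t : ℝ)) (t : ℝ) := by
  have h1 := hY.hasDerivWithinAt_apply_pow hτ n t
  have h2 : HasDerivAt (fun x : ℝ => Complex.exp ((n : ℂ) * (x : ℂ) / 2))
      (Complex.exp ((n : ℂ) * ((t : ℝ) : ℂ) / 2) * ((n : ℂ) / 2)) (t : ℝ) := by
    have h3 : HasDerivAt (fun x : ℝ => (n : ℂ) * (x : ℂ) / 2) ((n : ℂ) / 2) (t : ℝ) := by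
      simpa using ((Complex.ofRealCLM.hasDerivAt (x := (t : ℝ))).const_mul (n : ℂ)).div_const 2
    exact h3.cexp
  have h4 := h2.hasDerivWithinAt.mul h1
  have e : ∀ x ∈ Set.Ici (t : ℝ), momentQ τ Y n x.toNNReal =
      Complex.exp ((n : ℂ) * (x : ℂ) / 2) * τ (Y x.toNNReal ^ n) := by
    intro x hx
    rw [momentQ, Real.coe_toNNReal x (t.coe_nonneg.trans hx)]
  refine (h4.congr e (e _ (Set.mem_Ici.mpr le_rfl))).congr_deriv ?_
  have e2 : ∀ p ∈ Finset.Ico 1 n, momentQ τ Y p t * momentQ τ Y (n - p) t =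
      Complex.exp ((n : ℂ) * ((t : ℝ) : ℂ) / 2) * (τ (Y t ^ p) * τ (Y t ^ (n - p))) := by
    intro p hp
    have hp' : p ≤ n := (Finset.mem_Ico.mp hp).2.le
    have : Complex.exp ((n : ℂ) * ((t : ℝ) : ℂ) / 2) = Complex.exp ((p : ℂ) * ((t : ℝ) : ℂ) / 2)
        * Complex.exp (((n - p : ℕ) : ℂ) * ((t : ℝ) : ℂ) / 2) := by
      rw [← Complex.exp_add, Nat.cast_sub hp']
      congr 1; ring
    rw [this, momentQ, momentQ]
    ring
  rw [Finset.sum_congr rfl e2, ← Finset.mul_sum, Real.toNNReal_coe]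
  push_cast
  ring

end IsFreeUnitaryBrownianMotion

end MomentEquation

/-! ### Formal Lagrange inversion -/

section Lagrange

open PowerSeries

variable {K : Type*} [Field K]

/-- The partial sum `∑_{k < m} a_k F ^ k` of a composition of power series. -/
def powerSum (a : ℕ → K) (F : K⟦X⟧) (m : ℕ) : K⟦X⟧ :=
  ∑ k ∈ Finset.range m, C (a k) * F ^ k

/-- The `k`-th coefficient, for `k ≥ 1`, of `H ∘ g`, where `g` is the compositional inverse
of `X / φ`. -/
def lagrangeCoeff (φ H : K⟦X⟧) (k : ℕ) : K :=
  coeff (k - 1) (d⁄dX K H * φ ^ k) / k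

theorem powerSum_eq_eval₂ (a : ℕ → K) (F : K⟦X⟧) (m : ℕ) :
    powerSum a F m = (trunc m (PowerSeries.mk a)).eval₂ C F := by
  simp [powerSum, eval₂_trunc_eq_sum_range]

/-- The product of truncations agrees with the truncation of the product modulo `X ^ m`; evaluate
this polynomial congruence at `F`. -/
theorem powerSum_mul_sub_dvd (a b : K⟦X⟧) (F : K⟦X⟧) (m : ℕ) :
    F ^ m ∣ powerSum (fun k => coeff k a) F m * powerSum (fun k => coeff k b) F m
      - powerSum (fun k => coeff k (a * b)) F m := by
  have hmk : ∀ c : K⟦X⟧, (PowerSeries.mk fun k => coeff k c) = c := fun c => by ext; simp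
  have h : (Polynomial.X : Polynomial K) ^ m ∣ trunc m a * trunc m b - trunc m (a * b) := by
    rw [Polynomial.X_pow_dvd_iff]
    intro d hd
    rw [Polynomial.coeff_sub, coeff_trunc, if_pos hd, coeff_mul_eq_coeff_trunc_mul_trunc a b hd,
      ← Polynomial.coe_mul, Polynomial.coeff_coe, sub_self]
  obtain ⟨c, hc⟩ := h
  refine ⟨c.eval₂ C F, ?_⟩
  rw [powerSum_eq_eval₂, powerSum_eq_eval₂, powerSum_eq_eval₂, hmk, hmk, hmk, ← Polynomial.eval₂_mul,
    ← Polynomial.eval₂_sub, hc, Polynomial.eval₂_mul, Polynomial.eval₂_X_pow]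

/-- Triangularity: `(X ψ) ^ k` begins with `X ^ k`, so `a k` is exposed once the earlier
coefficients vanish. -/
theorem eq_zero_of_dvd_powerSum {ψ : K⟦X⟧} (hψ : constantCoeff ψ = 1) {a : ℕ → K}
    (h : ∀ m, X ^ (m + 1) ∣ powerSum a (X * ψ) (m + 1)) (k : ℕ) : a k = 0 := by
  induction k using Nat.strong_induction_on with
  | _ k ih =>
    have h1 := X_pow_dvd_iff.mp (h k) k (Nat.lt_succ_self k)
    rw [powerSum, Finset.sum_range_succ, Finset.sum_eq_zero, zero_add, mul_pow, coeff_C_mul] at h1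
    · have h2 := coeff_X_pow_mul (ψ ^ k) k 0
      rw [zero_add, coeff_zero_eq_constantCoeff_apply, map_pow, hψ, one_pow] at h2
      simpa [h2] using h1
    · intro j hj
      rw [ih j (Finset.mem_range.mp hj), map_zero, zero_mul]

variable [CharZero K] {φ ψ : K⟦X⟧}

/-- With `F = X ψ`, the coefficient is the residue of `(F^k)' F^{-n}`, which is a multiple of the
derivative of `F^{k-n}` and so has residue zero. -/
theorem coeff_derivative_pow_mul_pow (hψφ : ψ * φ = 1) {k n : ℕ} (hkn : k < n) :
    coeff (n - 1) (d⁄dX K ((X * ψ) ^ k) * φ ^ n) = 0 := by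
  rcases Nat.eq_zero_or_pos k with rfl | hk
  · simp
  obtain ⟨d, rfl⟩ := Nat.exists_eq_add_of_lt hkn
  obtain ⟨k, rfl⟩ := Nat.exists_eq_add_of_lt hk
  simp only [zero_add] at *
  have hpow : ∀ j, (X * ψ) ^ j * φ ^ j = X ^ j := fun j => by
    rw [← mul_pow, mul_assoc, hψφ, mul_one]
  have h1 : d⁄dX K ((X * ψ) ^ (k + 1)) * φ ^ (k + 1)
      + (X * ψ) ^ (k + 1) * d⁄dX K (φ ^ (k + 1)) = ((k + 1 : ℕ) : K⟦X⟧) * X ^ k := by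
    have h := congrArg (d⁄dX K) (hpow (k + 1))
    rw [Derivation.leibniz, derivative_pow (X : K⟦X⟧), derivative_X, mul_one, smul_eq_mul,
      smul_eq_mul, Nat.add_sub_cancel] at h
    rw [← h]; ring
  -- Here `d + 1` is `n - k`. With `G = φ ^ (d + 1)` the right side is a multiple of `X^k ((d+1) G -
  -- X G')`, and the bracket has no term of degree `d + 1`.
  have h2 : ((d + 1 : ℕ) : K⟦X⟧) * (d⁄dX K ((X * ψ) ^ (k + 1)) * φ ^ (k + 1 + d + 1)) =
      ((k + 1 : ℕ) : K⟦X⟧) * (X ^ k * (((d + 1 : ℕ) : K⟦X⟧) * φ ^ (d + 1)))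
        - ((k + 1 : ℕ) : K⟦X⟧) * (X ^ k * (X * d⁄dX K (φ ^ (d + 1)))) := by
    rw [derivative_pow φ, Nat.add_sub_cancel] at *
    have h3 := hpow (k + 1)
    have h4 : d⁄dX K ((X * ψ) ^ (k + 1)) * φ ^ (k + 1 + d + 1) =
        (d⁄dX K ((X * ψ) ^ (k + 1)) * φ ^ (k + 1)) * φ ^ (d + 1) := by ring
    rw [h4]
    linear_combination (((d + 1 : ℕ) : K⟦X⟧) * φ ^ (d + 1)) * h1
      - (((d + 1 : ℕ) : K⟦X⟧) * ((k + 1 : ℕ) : K⟦X⟧) * φ ^ d * d⁄dX K φ) * h3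
  have h5 := congrArg (coeff (k + 1 + d)) h2
  simp only [map_sub, ← map_natCast (C (R := K)), coeff_C_mul] at h5
  rw [show k + 1 + d = (d + 1) + k by ring, coeff_X_pow_mul, coeff_X_pow_mul, coeff_C_mul,
    coeff_succ_X_mul, coeff_derivative] at h5
  have h6 : ((d + 1 : ℕ) : K) ≠ 0 := Nat.cast_ne_zero.mpr (Nat.succ_ne_zero d)
  rw [show k + 1 + d + 1 - 1 = (d + 1) + k by omega, show k + 1 + d + 1 = d + 1 + k + 1 by ring]
  refine (mul_eq_zero.mp (h5.trans ?_)).resolve_left h6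
  push_cast
  ring

/-- Lagrange inversion. -/
theorem X_pow_dvd_sub_powerSum_lagrangeCoeff (hψφ : ψ * φ = 1) (hφ : constantCoeff φ = 1)
    {H : K⟦X⟧} (hH : constantCoeff H = 0) (m : ℕ) :
    X ^ (m + 1) ∣ H - powerSum (lagrangeCoeff φ H) (X * ψ) (m + 1) := by
  have hψ : constantCoeff ψ = 1 := by
    have := congrArg (constantCoeff (R := K)) hψφ
    simpa [hφ] using this
  induction m with
  | zero =>
    rw [zero_add, pow_one, X_dvd_iff]
    -- The zeroth Lagrange coefficient is `0` by division by zero.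
    simp [powerSum, lagrangeCoeff, hH]
  | succ m ih =>
    obtain ⟨e, he⟩ := ih
    -- Lower powers of `X ψ` do not contribute to this coefficient, so it sees only the error `X ^
    -- (m + 1) * e`.
    have hsum : coeff m (d⁄dX K (powerSum (lagrangeCoeff φ H) (X * ψ) (m + 1)) * φ ^ (m + 1))
        = 0 := by
      rw [powerSum, map_sum, Finset.sum_mul, map_sum]
      refine Finset.sum_eq_zero fun k hk => ?_
      rw [Derivation.leibniz, derivative_C, smul_zero, add_zero, smul_eq_mul, mul_assoc, coeff_C_mul]
      exact mul_eq_zero_of_right _ (coeff_derivative_pow_mul_pow hψφ (Finset.mem_range.mp hk))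
    have hcoef : coeff m (d⁄dX K H * φ ^ (m + 1)) = ((m + 1 : ℕ) : K) * constantCoeff e := by
      have h1 : H = X ^ (m + 1) * e + powerSum (lagrangeCoeff φ H) (X * ψ) (m + 1) := by
        rw [← he]; ring
      have h2 : d⁄dX K (X ^ (m + 1) * e) * φ ^ (m + 1) =
          X ^ m * ((C ((m + 1 : ℕ) : K) * e + X * d⁄dX K e) * φ ^ (m + 1)) := by
        rw [Derivation.leibniz, derivative_pow (X : K⟦X⟧), derivative_X, mul_one, smul_eq_mul,
          smul_eq_mul, Nat.add_sub_cancel, map_natCast]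
        ring
      conv_lhs => rw [h1]
      rw [map_add, add_mul, map_add, hsum, add_zero, h2]
      have h3 := coeff_X_pow_mul ((C ((m + 1 : ℕ) : K) * e + X * d⁄dX K e) * φ ^ (m + 1)) m 0
      rw [zero_add] at h3
      rw [h3]
      simp [hφ]
    have hm : ((m + 1 : ℕ) : K) ≠ 0 := Nat.cast_ne_zero.mpr (Nat.succ_ne_zero m)
    have hlc : lagrangeCoeff φ H (m + 1) = constantCoeff e := by
      rw [lagrangeCoeff, Nat.add_sub_cancel, hcoef, mul_div_cancel_left₀ _ hm]
    have hE : H - powerSum (lagrangeCoeff φ H) (X * ψ) (m + 1 + 1) =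
        X ^ (m + 1) * (e - C (constantCoeff e) * ψ ^ (m + 1)) := by
      rw [powerSum, Finset.sum_range_succ, hlc, ← sub_sub]
      change H - powerSum _ _ _ - _ = _
      rw [he, mul_pow]
      ring
    rw [hE, pow_succ X (m + 1)]
    refine mul_dvd_mul_left _ (X_dvd_iff.mpr ?_)
    simp [hψ]

/-- The coefficients of the square of the compositional inverse of `X / φ`. -/
theorem sum_antidiagonal_lagrangeCoeff_X (hψφ : ψ * φ = 1) (hφ : constantCoeff φ = 1) (n : ℕ) :
    ∑ p ∈ Finset.HasAntidiagonal.antidiagonal n, lagrangeCoeff φ X p.1 * lagrangeCoeff φ X p.2 =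
      lagrangeCoeff φ (X * X) n := by
  have hψ : constantCoeff ψ = 1 := by
    have := congrArg (constantCoeff (R := K)) hψφ
    simpa [hφ] using this
  set q : K⟦X⟧ := PowerSeries.mk (lagrangeCoeff φ X) with hq
  set p : K⟦X⟧ := PowerSeries.mk (lagrangeCoeff φ (X * X)) with hp
  have hqc : (fun k => coeff k q) = lagrangeCoeff φ X := by ext k; simp [hq]
  have hpc : (fun k => coeff k p) = lagrangeCoeff φ (X * X) := by ext k; simp [hp]
  -- Modulo `X ^ (m + 1)`, the power sum of `q` is `X`, so that of `q * q` is `X * X`, as is that of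
  -- `p`; uniqueness of coefficients then gives `q * q = p`.
  have key : ∀ m, X ^ (m + 1) ∣ powerSum (fun k => coeff k (q * q - p)) (X * ψ) (m + 1) := by
    intro m
    obtain ⟨c1, h1⟩ := X_pow_dvd_sub_powerSum_lagrangeCoeff hψφ hφ (H := X) (by simp) m
    obtain ⟨c2, h2⟩ := X_pow_dvd_sub_powerSum_lagrangeCoeff hψφ hφ (H := X * X) (by simp) m
    obtain ⟨c3, h3⟩ := powerSum_mul_sub_dvd q q (X * ψ) (m + 1)
    rw [hqc] at h3
    have h4 : powerSum (fun k => coeff k (q * q - p)) (X * ψ) (m + 1) =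
        powerSum (fun k => coeff k (q * q)) (X * ψ) (m + 1)
          - powerSum (lagrangeCoeff φ (X * X)) (X * ψ) (m + 1) := by
      rw [← hpc, powerSum, powerSum, powerSum, ← Finset.sum_sub_distrib]
      exact Finset.sum_congr rfl fun k _ => by rw [map_sub, map_sub, sub_mul]
    rw [h4]
    set s := powerSum (lagrangeCoeff φ X) (X * ψ) (m + 1)
    refine ⟨c2 - c1 * (X + s) - ψ ^ (m + 1) * c3, ?_⟩
    rw [mul_pow] at h3
    linear_combination h2 - h3 - (X + s) * h1
  have h0 := eq_zero_of_dvd_powerSum hψ key n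
  rw [map_sub, sub_eq_zero, coeff_mul] at h0
  simpa [hq, hp] using h0

end Lagrange

/-! ### The Laguerre formula for the free unitary Brownian motion -/

section Moments

open PowerSeries

/-- The power series `(1 + X) e ^ (-t X)`. -/
def phi (t : ℂ) : ℂ⟦X⟧ := (1 + X) * rescale (-t) (PowerSeries.exp ℂ)

theorem constantCoeff_phi (t : ℂ) : constantCoeff (phi t) = 1 := by
  have h := coeff_rescale (PowerSeries.exp ℂ) (-t) 0
  rw [coeff_zero_eq_constantCoeff_apply] at h
  simp [phi, h]

theorem coeff_phi_pow (t : ℂ) (n m : ℕ) :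
    coeff m (phi t ^ n) =
      ∑ j ∈ Finset.range (m + 1), (n.choose (m - j) : ℂ) * ((-(n * t)) ^ j / j.factorial) := by
  have h1 : rescale (-t) (PowerSeries.exp ℂ) ^ n = rescale (-(n * t)) (PowerSeries.exp ℂ) := by
    rw [← map_pow, exp_pow_eq_rescale_exp, rescale_rescale]
    rw [mul_neg]
  have h2 : ∀ k, coeff k ((1 + X : ℂ⟦X⟧) ^ n) = (n.choose k : ℂ) := fun k => by
    have h3 : ((1 + X : ℂ⟦X⟧) ^ n) = (((1 + Polynomial.X : Polynomial ℂ) ^ n : Polynomial ℂ)) := by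
      simp
    rw [h3, Polynomial.coeff_coe, Polynomial.coeff_one_add_X_pow]
  rw [phi, mul_pow, h1, mul_comm, coeff_mul, Finset.Nat.sum_antidiagonal_eq_sum_range_succ_mk]
  refine Finset.sum_congr rfl fun j _ => ?_
  rw [h2, coeff_rescale, coeff_exp]
  simp only [one_div, map_inv₀, map_natCast]
  ring

/-- This is `∂ₜ φ^n = -n X φ^n`, coefficient by coefficient. -/
theorem hasDerivAt_coeff_phi_pow_succ (n m : ℕ) (t : ℝ) :
    HasDerivAt (fun x : ℝ => coeff (m + 1) (phi x ^ n)) (-(n * coeff m (phi t ^ n))) t := by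
  simp only [coeff_phi_pow]
  have h1 : HasDerivAt (fun x : ℝ => -((n : ℂ) * (x : ℂ))) (-(n : ℂ)) t := by
    simpa using ((Complex.ofRealCLM.hasDerivAt (x := t)).const_mul (n : ℂ)).fun_neg
  have h2 : ∀ j ∈ Finset.range (m + 1 + 1), HasDerivAt
      (fun x : ℝ => (n.choose (m + 1 - j) : ℂ) * ((-(n * (x : ℂ))) ^ j / j.factorial))
      ((n.choose (m + 1 - j) : ℂ) * (j * (-(n * (t : ℂ))) ^ (j - 1) * (-n) / j.factorial)) t :=
    fun j _ => ((h1.fun_pow j).div_const _).const_mul _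
  refine (HasDerivAt.fun_sum h2).congr_deriv ?_
  rw [Finset.sum_range_succ', Finset.mul_sum, ← Finset.sum_neg_distrib]
  simp only [Nat.cast_zero, zero_mul, zero_div, mul_zero, add_zero]
  refine Finset.sum_congr rfl fun j _ => ?_
  rw [Nat.add_sub_add_right, Nat.add_sub_cancel, Nat.factorial_succ, Nat.cast_mul]
  have h3 : (j.factorial : ℂ) ≠ 0 := Nat.cast_ne_zero.mpr j.factorial_ne_zero
  have h4 : ((j + 1 : ℕ) : ℂ) ≠ 0 := Nat.cast_ne_zero.mpr j.succ_ne_zero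
  field_simp

theorem lagrangeCoeff_phi_X (t : ℂ) (n : ℕ) :
    lagrangeCoeff (phi t) X n = coeff (n - 1) (phi t ^ n) / n := by
  rw [lagrangeCoeff, derivative_X, one_mul]

theorem lagrangeCoeff_phi_X_eq_laguerre (t : ℂ) {n : ℕ} (hn : 1 ≤ n) :
    lagrangeCoeff (phi t) X n = laguerre 1 (n - 1) (n * t) / n := by
  rw [lagrangeCoeff_phi_X, coeff_phi_pow, laguerre, Nat.sub_add_cancel hn]
  congr 1
  refine Finset.sum_congr rfl fun j _ => ?_
  rw [neg_pow]
  ring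

/-- Lagrange inversion for `H = X²`, where `H' = 2X`; the two end terms of the convolution vanish
with the zeroth coefficient. -/
theorem sum_Ico_lagrangeCoeff_phi_X (t : ℂ) (n : ℕ) :
    (n + 2 : ℕ) / 2 * ∑ p ∈ Finset.Ico 1 (n + 2), lagrangeCoeff (phi t) X p *
      lagrangeCoeff (phi t) X (n + 2 - p) = coeff n (phi t ^ (n + 2)) := by
  have hφ := constantCoeff_phi t
  have h := sum_antidiagonal_lagrangeCoeff_X
    (PowerSeries.inv_mul_cancel _ (by rw [hφ]; exact one_ne_zero)) hφ (n + 2)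
  have h0 : lagrangeCoeff (phi t) X 0 = 0 := by simp [lagrangeCoeff]
  rw [Finset.Nat.sum_antidiagonal_eq_sum_range_succ_mk, Finset.sum_range_succ, Nat.sub_self, h0,
    mul_zero, add_zero, Finset.range_eq_Ico, Finset.sum_eq_sum_Ico_succ_bot (by omega), h0,
    zero_mul, zero_add, zero_add] at h
  have h1 : d⁄dX ℂ (X * X : ℂ⟦X⟧) = C 2 * X := by
    rw [Derivation.leibniz, derivative_X, smul_eq_mul, mul_one, map_ofNat]
    ring
  rw [h, lagrangeCoeff, h1, mul_assoc, coeff_C_mul, show n + 2 - 1 = n + 1 by omega,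
    coeff_succ_X_mul]
  have : ((n + 2 : ℕ) : ℂ) ≠ 0 := Nat.cast_ne_zero.mpr (by omega)
  field_simp

theorem hasDerivAt_lagrangeCoeff_phi_X (n : ℕ) (t : ℝ) :
    HasDerivAt (fun x : ℝ => lagrangeCoeff (phi x) X n)
      (-((n : ℂ) / 2 * ∑ p ∈ Finset.Ico 1 n,
        lagrangeCoeff (phi t) X p * lagrangeCoeff (phi t) X (n - p))) t := by
  rcases n with _ | _ | n
  · simpa [lagrangeCoeff] using hasDerivAt_const t (0 : ℂ)
  · have : (fun x : ℝ => lagrangeCoeff (phi x) X (0 + 1)) = fun _ => 1 := by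
      ext x
      simp [lagrangeCoeff, constantCoeff_phi]
    rw [this]
    simpa using hasDerivAt_const t (1 : ℂ)
  · simp only [lagrangeCoeff_phi_X (n := n + 1 + 1)]
    refine ((hasDerivAt_coeff_phi_pow_succ (n + 2) n t).div_const ((n + 2 : ℕ) : ℂ)).congr_deriv ?_
    rw [show n + 1 + 1 = n + 2 by ring, sum_Ico_lagrangeCoeff_phi_X]
    have : ((n + 2 : ℕ) : ℂ) ≠ 0 := Nat.cast_ne_zero.mpr (by omega)
    field_simp

theorem lagrangeCoeff_phi_X_zero {n : ℕ} (hn : 1 ≤ n) : lagrangeCoeff (phi 0) X n = 1 := by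
  have hn0 : (n : ℂ) ≠ 0 := Nat.cast_ne_zero.mpr (by omega)
  rw [lagrangeCoeff_phi_X, coeff_phi_pow, Nat.sub_add_cancel hn, Finset.sum_eq_single_of_mem 0]
  · have : n.choose (n - 1) = n := by
      rw [Nat.choose_symm hn, Nat.choose_one_right]
    simp [this, hn0]
  · exact Finset.mem_range.mpr hn
  · intro j _ hj
    simp [hj]

variable {A : Type*} [CStarAlgebra A] {τ : A →ₗ[ℂ] ℂ} {Y : ℝ≥0 → A}

/-- Both sides solve the same system, whose right side involves only smaller indices. By induction
their difference has zero right derivative, and it vanishes at `0`. -/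
theorem IsFreeUnitaryBrownianMotion.momentQ_eq (hY : IsFreeUnitaryBrownianMotion τ Y)
    (hτ : IsTracialState τ) (n : ℕ) (hn : 1 ≤ n) (t : ℝ≥0) :
    momentQ τ Y n t = lagrangeCoeff (phi (t : ℝ)) X n := by
  induction n using Nat.strong_induction_on generalizing t with
  | _ n ih =>
    set g : ℝ → ℂ := fun x => momentQ τ Y n x.toNNReal - lagrangeCoeff (phi x) X n with hg
    have hQ : Continuous fun x : ℝ => momentQ τ Y n x.toNNReal := by
      have h1 : Continuous fun x : ℝ => Y x.toNNReal := hY.continuous.comp continuous_real_toNNReal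
      have h2 : Continuous fun x : ℝ => τ (Y x.toNNReal ^ n) := hτ.continuous.comp (h1.pow n)
      have h3 : Continuous fun x : ℝ => ((x.toNNReal : ℝ) : ℂ) :=
        Complex.continuous_ofReal.comp (NNReal.continuous_coe.comp continuous_real_toNNReal)
      unfold momentQ
      exact (Complex.continuous_exp.comp ((continuous_const.mul h3).div_const 2)).mul h2
    have hq : Continuous fun x : ℝ => lagrangeCoeff (phi x) X n :=
      continuous_iff_continuousAt.mpr fun x => (hasDerivAt_lagrangeCoeff_phi_X n x).continuousAt
    have hderiv : ∀ x ∈ Set.Ico (0 : ℝ) t, HasDerivWithinAt g 0 (Set.Ici x) x := by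
      intro x hx
      lift x to ℝ≥0 using hx.1
      have h1 := (hY.hasDerivWithinAt_momentQ hτ n x).sub
        (hasDerivAt_lagrangeCoeff_phi_X n x).hasDerivWithinAt
      refine h1.congr_deriv ?_
      rw [sub_eq_zero]
      congr 2
      refine Finset.sum_congr rfl fun p hp => ?_
      obtain ⟨h2, h3⟩ := Finset.mem_Ico.mp hp
      rw [ih p h3 h2, ih (n - p) (by omega) (by omega)]
    have hconst : g t = g 0 := constant_of_has_deriv_right_zero (hQ.sub hq).continuousOn hderiv t
      ⟨t.coe_nonneg, le_rfl⟩
    have h0 : g 0 = 0 := by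
      simp [hg, momentQ, hY.apply_zero, hτ.map_one, lagrangeCoeff_phi_X_zero hn]
    rw [h0] at hconst
    simpa [hg, sub_eq_zero] using hconst

end Moments

/-! ### Power series and germs of analytic functions -/

section Represents

open PowerSeries Topology

/-- The power series `p` converges to `f` near `0`. -/
def Represents (p : ℂ⟦X⟧) (f : ℂ → ℂ) : Prop :=
  ∀ᶠ z in 𝓝 (0 : ℂ), HasSum (fun n => coeff n p * z ^ n) (f z)

namespace Represents

variable {p q : ℂ⟦X⟧} {f g : ℂ → ℂ}

theorem hasFPowerSeriesAt (h : Represents p f) :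
    HasFPowerSeriesAt f (FormalMultilinearSeries.ofScalars ℂ fun n => coeff n p) 0 := by
  rw [hasFPowerSeriesAt_iff]
  filter_upwards [h] with z hz
  simpa [FormalMultilinearSeries.coeff_ofScalars, mul_comm] using hz

theorem analyticAt (h : Represents p f) : AnalyticAt ℂ f 0 := h.hasFPowerSeriesAt.analyticAt

theorem unique (hp : Represents p f) (hq : Represents q f) : p = q := by
  have h := hp.hasFPowerSeriesAt.eq_formalMultilinearSeries hq.hasFPowerSeriesAt
  ext n
  simpa [FormalMultilinearSeries.coeff_ofScalars] using congrArg (fun s => s.coeff n) h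

theorem congr (hp : Represents p f) (h : ∀ᶠ z in 𝓝 (0 : ℂ), f z = g z) : Represents p g := by
  filter_upwards [hp, h] with z h1 h2
  rwa [← h2]

theorem eventually_eq (hp : Represents p f) (hq : Represents p g) :
    ∀ᶠ z in 𝓝 (0 : ℂ), f z = g z := by
  filter_upwards [hp, hq] with z h1 h2
  exact h1.unique h2

theorem add (hp : Represents p f) (hq : Represents q g) :
    Represents (p + q) fun z => f z + g z := by
  filter_upwards [hp, hq] with z h1 h2
  simpa [add_mul] using h1.add h2

theorem mul (hp : Represents p f) (hq : Represents q g) :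
    Represents (p * q) fun z => f z * g z := by
  filter_upwards [hp, hq] with z h1 h2
  have h3 := hasSum_sum_range_mul_of_summable_norm h1.summable.norm h2.summable.norm
  rw [h1.tsum_eq, h2.tsum_eq] at h3
  refine h3.congr_fun fun n => ?_
  rw [coeff_mul, Finset.Nat.sum_antidiagonal_eq_sum_range_succ_mk, Finset.sum_mul]
  refine Finset.sum_congr rfl fun k hk => ?_
  have : k ≤ n := Nat.lt_succ_iff.mp (Finset.mem_range.mp hk)
  rw [mul_mul_mul_comm, ← pow_add, Nat.add_sub_cancel' this]

theorem const (c : ℂ) : Represents (C c) fun _ => c := by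
  refine Filter.Eventually.of_forall fun z => ?_
  have h := hasSum_single (f := fun n => coeff n (C c : ℂ⟦X⟧) * z ^ n) 0
    fun n hn => by simp [coeff_C, hn]
  simpa using h

theorem id : Represents X fun z => z := by
  refine Filter.Eventually.of_forall fun z => ?_
  have h := hasSum_single (f := fun n => coeff n (X : ℂ⟦X⟧) * z ^ n) 1
    fun n hn => by simp [coeff_X, hn]
  simpa using h

theorem pow (hp : Represents p f) (k : ℕ) : Represents (p ^ k) fun z => f z ^ k := by
  induction k with
  | zero => simpa using const 1
  | succ k ih => simpa only [pow_succ] using ih.mul hp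

theorem powerSum (hp : Represents p f) (a : ℕ → ℂ) (m : ℕ) :
    Represents (powerSum a p m) fun z => ∑ k ∈ Finset.range m, a k * f z ^ k := by
  induction m with
  | zero => simpa [FreeProb.powerSum] using const 0
  | succ m ih =>
    have h : FreeProb.powerSum a p (m + 1) = FreeProb.powerSum a p m + C (a m) * p ^ m :=
      Finset.sum_range_succ _ _
    rw [h]
    simpa only [Finset.sum_range_succ] using ih.add ((const (a m)).mul (hp.pow m))

theorem exists_of_analyticAt (h : AnalyticAt ℂ f 0) : ∃ p : ℂ⟦X⟧, Represents p f := by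
  obtain ⟨s, hs⟩ := h
  refine ⟨PowerSeries.mk s.coeff, ?_⟩
  have := hasFPowerSeriesAt_iff.mp hs
  filter_upwards [this] with z hz
  simpa [mul_comm] using hz

/-- A convergent remainder after a Taylor polynomial lets formal congruences modulo `X ^ m` act on
germs. -/
theorem exists_shift (hp : Represents p f) (m : ℕ) :
    ∃ g, Represents (PowerSeries.mk fun k => coeff (k + m) p) g ∧
      ∀ᶠ z in 𝓝 (0 : ℂ), f z = ∑ i ∈ Finset.range m, coeff i p * z ^ i + z ^ m * g z := by
  refine ⟨fun z => ∑' n, coeff (n + m) p * z ^ n, ?_, ?_⟩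
  · filter_upwards [hp] with z hz
    simp only [coeff_mk]
    refine Summable.hasSum ?_
    rcases eq_or_ne z 0 with rfl | hz0
    · exact (hasSum_single (f := fun n => coeff (n + m) p * (0 : ℂ) ^ n) 0
        fun n hn => by simp [hn]).summable
    · have h1 := ((summable_nat_add_iff m).mpr hz.summable).mul_right (z ^ m)⁻¹
      refine h1.congr fun n => ?_
      rw [pow_add]
      field_simp
  · filter_upwards [hp] with z hz
    rw [← tsum_mul_left, ← hz.tsum_eq, ← hz.summable.sum_add_tsum_nat_add m]
    congr 1
    exact tsum_congr fun n => by ring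

/-- The analytic form of Lagrange inversion for the function `y / ((1 + y) e ^ (-t y))`. -/
theorem eventually_apply_eq {t : ℂ} {Ψ : ℂ → ℂ}
    (hΨ : Represents (PowerSeries.mk (lagrangeCoeff (phi t) X)) Ψ) :
    ∀ᶠ y in 𝓝 (0 : ℂ), Ψ (y * ((1 + y) * Complex.exp (-t * y))⁻¹) = y := by
  have hexp : Represents (rescale (-t) (PowerSeries.exp ℂ)) fun y => Complex.exp (-t * y) := by
    refine Filter.Eventually.of_forall fun y => ?_
    have h := NormedSpace.expSeries_div_hasSum_exp (-t * y)
    rw [← Complex.exp_eq_exp_ℂ] at h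
    refine h.congr_fun fun n => ?_
    rw [coeff_rescale, coeff_exp, mul_pow]
    simp only [one_div, map_inv₀, map_natCast]
    ring
  have hphi : Represents (phi t) fun y => (1 + y) * Complex.exp (-t * y) := by
    have h1 := (const 1).add Represents.id
    rw [map_one] at h1
    exact h1.mul hexp
  have hne : ∀ᶠ y in 𝓝 (0 : ℂ), (1 + y) * Complex.exp (-t * y) ≠ 0 :=
    hphi.analyticAt.continuousAt.eventually_ne (by simp)
  obtain ⟨ψ, hψ⟩ := exists_of_analyticAt (hphi.analyticAt.inv (by simp))
  have hψφ : ψ * phi t = 1 := by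
    refine (hψ.mul hphi).unique ?_
    have h1 := const 1
    rw [map_one] at h1
    refine h1.congr ?_
    filter_upwards [hne] with y hy
    exact (inv_mul_cancel₀ hy).symm
  set F : ℂ → ℂ := fun y => y * ((1 + y) * Complex.exp (-t * y))⁻¹ with hF
  have hFr : Represents (X * ψ) F := Represents.id.mul hψ
  have hF0 : F 0 = 0 := by simp [hF]
  have hFt : Filter.Tendsto F (𝓝 0) (𝓝 0) := by
    simpa only [ContinuousAt, hF0] using hFr.analyticAt.continuousAt
  have hcomp : ∀ {G : ℂ → ℂ}, AnalyticAt ℂ G 0 → AnalyticAt ℂ (fun y => G (F y)) 0 := fun hG =>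
    AnalyticAt.fun_comp (by rwa [hF0]) hFr.analyticAt
  obtain ⟨r, hr⟩ := exists_of_analyticAt (hcomp hΨ.analyticAt)
  -- The series `r` of `Ψ ∘ F` agrees with `X` to every finite order: the polynomial part of `Ψ` is
  -- handled by formal inversion, and the remainder carries a factor `F ^ (m + 1)`.
  have hrX : r = X := by
    ext m
    obtain ⟨Θ, hΘ, hΨΘ⟩ := hΨ.exists_shift (m + 1)
    obtain ⟨r', hr'⟩ := exists_of_analyticAt (hcomp hΘ.analyticAt)
    have h1 := (hFr.powerSum (lagrangeCoeff (phi t) X) (m + 1)).add ((hFr.pow (m + 1)).mul hr')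
    have h2 := h1.unique (hr.congr (by
      filter_upwards [hFt.eventually hΨΘ] with y hy
      simpa using hy))
    obtain ⟨c, hc⟩ := X_pow_dvd_sub_powerSum_lagrangeCoeff hψφ (constantCoeff_phi t)
      (H := (X : ℂ⟦X⟧)) (by simp) m
    have h3 : r = X + X ^ (m + 1) * (ψ ^ (m + 1) * r' - c) := by
      rw [← h2, mul_pow]
      linear_combination -hc
    rw [h3, map_add, coeff_X_pow_mul', if_neg (by omega), add_zero]
  exact eventually_eq (hrX ▸ hr) Represents.id

end Represents

end Represents

/-! ### The resolvent of a projection times a free element -/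

section Compression

open Topology

/-- The alternating list of factors of the word `(x z) ^ n`, followed by the list `L`. -/
def alternatingList {B : Type*} (x z : B) (L : List (Fin 2 × B)) : ℕ → List (Fin 2 × B)
  | 0 => L
  | n + 1 => (0, x) :: (1, z) :: alternatingList x z L n

theorem isChain_alternatingList {B : Type*} (x z : B) (L : List (Fin 2 × B))
    (hL : ((1, z) :: L).IsChain fun x y => x.1 ≠ y.1) (n : ℕ) :
    ((1, z) :: alternatingList x z L n).IsChain fun x y => x.1 ≠ y.1 := by
  induction n with
  | zero => exact hL
  | succ n ih => simpa [alternatingList] using ih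

theorem forall_mem_alternatingList {B : Type*} {Q : Fin 2 × B → Prop} {x z : B} {L : List (Fin 2 × B)}
    (hx : Q (0, x)) (hz : Q (1, z)) (hL : ∀ a ∈ L, Q a) (n : ℕ) :
    ∀ a ∈ alternatingList x z L n, Q a := by
  induction n with
  | zero => exact hL
  | succ n ih => exact List.forall_mem_cons.mpr ⟨hx, List.forall_mem_cons.mpr ⟨hz, ih⟩⟩

variable {A : Type*} [CStarAlgebra A] {τ : A →ₗ[ℂ] ℂ} {S T : StarSubalgebra ℂ A}

theorem prod_alternatingList (x z : A) (L : List (Fin 2 × A)) (n : ℕ) :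
    ((alternatingList x z L n).map Prod.snd).prod = (x * z) ^ n * (L.map Prod.snd).prod := by
  induction n with
  | zero => simp [alternatingList]
  | succ n ih => simp [alternatingList, ih, pow_succ', mul_assoc]

namespace IsFreePair

variable {x z : A}

theorem apply_mul_pow (h : IsFreePair τ S T) (hx : x ∈ S) (hx0 : τ x = 0) (hz : z ∈ T)
    (hz0 : τ z = 0) (n : ℕ) : τ ((x * z) ^ (n + 1)) = 0 := by
  have h1 := h (alternatingList x z [] (n + 1)) (by simp [alternatingList])
    (isChain_alternatingList x z [] (by simp) (n + 1)).tail
    (forall_mem_alternatingList (by simpa using ⟨hx, hx0⟩) (by simpa using ⟨hz, hz0⟩) (by simp) _)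
  simpa [prod_alternatingList] using h1

theorem apply_mul_pow_mul (h : IsFreePair τ S T) (hx : x ∈ S) (hx0 : τ x = 0) (hz : z ∈ T)
    (hz0 : τ z = 0) (n : ℕ) : τ ((x * z) ^ n * x) = 0 := by
  have h1 := h (alternatingList x z [(0, x)] n) (by cases n <;> simp [alternatingList])
    (isChain_alternatingList x z [(0, x)] (by simp) n).tail
    (forall_mem_alternatingList (by simpa using ⟨hx, hx0⟩) (by simpa using ⟨hz, hz0⟩)
      (by simpa using ⟨hx, hx0⟩) _)
  simpa [prod_alternatingList] using h1

theorem apply_mul_mul_pow (h : IsFreePair τ S T) (hx : x ∈ S) (hx0 : τ x = 0) (hz : z ∈ T)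
    (hz0 : τ z = 0) (n : ℕ) : τ (z * (x * z) ^ n) = 0 := by
  have h1 := h ((1, z) :: alternatingList x z [] n) (by simp)
    (isChain_alternatingList x z [] (by simp) n)
    (List.forall_mem_cons.mpr ⟨by simpa using ⟨hz, hz0⟩,
      forall_mem_alternatingList (by simpa using ⟨hx, hx0⟩) (by simpa using ⟨hz, hz0⟩) (by simp) _⟩)
  simpa [prod_alternatingList] using h1

/-- An identity for centered elements extends to the closure of the second algebra. -/
theorem eq_zero_of_mem_closure (hτ : IsTracialState τ) {f : A → A}
    (hf : Continuous f) (h : ∀ z ∈ T, τ z = 0 → τ (f z) = 0) {z : A}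
    (hz : z ∈ closure (T : Set A)) (hz0 : τ z = 0) : τ (f z) = 0 := by
  have hc : Continuous fun w : A => w - τ w • (1 : A) :=
    continuous_id.sub (hτ.continuous.smul continuous_const)
  have h1 : z - τ z • (1 : A) ∈ closure {w : A | τ (f w) = 0} :=
    map_mem_closure (f := fun w : A => w - τ w • (1 : A)) hc hz fun w hw => by
      obtain ⟨h2, h3⟩ := centered_mem hτ.map_one hw
      exact h _ h2 h3
  have h4 : IsClosed {w : A | τ (f w) = 0} :=
    isClosed_eq (hτ.continuous.comp hf) continuous_const
  rwa [hz0, zero_smul, sub_zero, h4.closure_eq] at h1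

/-- If `x` and `z` are centered, then so are all the words in them which occur in the expansion
of `(1 + z) (1 - x z)⁻¹ (c + d x)`, except for the constant one. -/
theorem apply_resolvent (h : IsFreePair τ S T) (hτ : IsTracialState τ) (hx : x ∈ S)
    (hx0 : τ x = 0) (hz : z ∈ closure (T : Set A)) (hz0 : τ z = 0) (hxz : ‖x * z‖ < 1) (c d : ℂ) :
    τ ((1 + z) * Ring.inverse (1 - x * z) * (c • 1 + d • x)) = c := by
  set w := Ring.inverse (1 - x * z) with hw
  have hsum : HasSum (fun n => (x * z) ^ n) w := by
    rw [hw, NormedRing.inverse_one_sub _ hxz]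
    exact (summable_geometric_of_norm_lt_one hxz).hasSum
  have key : ∀ a b : A, HasSum (fun n => τ (a * (x * z) ^ n * b)) (τ (a * w * b)) := fun a b =>
    ((hsum.mul_left a).mul_right b).map τ hτ.continuous
  have hword : ∀ n, τ ((x * z) ^ (n + 1)) = 0 := fun n =>
    eq_zero_of_mem_closure hτ (f := fun z => (x * z) ^ (n + 1)) (by fun_prop)
      (fun z hz hz0 => h.apply_mul_pow hx hx0 hz hz0 n) hz hz0
  have e1 : τ (1 * w * 1) = 1 := by
    refine (key 1 1).unique ?_
    have := hasSum_single (f := fun n => τ (1 * (x * z) ^ n * 1)) 0 fun n hn => by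
      obtain ⟨m, rfl⟩ := Nat.exists_eq_succ_of_ne_zero hn
      simpa using hword m
    simpa [hτ.map_one] using this
  have e2 : τ (z * w * 1) = 0 := by
    refine (key z 1).unique ((hasSum_zero).congr_fun fun n => ?_)
    rw [mul_one]
    exact eq_zero_of_mem_closure hτ (f := fun z => z * (x * z) ^ n) (by fun_prop)
      (fun z hz hz0 => h.apply_mul_mul_pow hx hx0 hz hz0 n) hz hz0
  have e3 : τ (1 * w * x) = 0 := by
    refine (key 1 x).unique ((hasSum_zero).congr_fun fun n => ?_)
    rw [one_mul]
    exact eq_zero_of_mem_closure hτ (f := fun z => (x * z) ^ n * x) (by fun_prop)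
      (fun z hz hz0 => h.apply_mul_pow_mul hx hx0 hz hz0 n) hz hz0
  -- Cyclically, `z (x z)^n x` is `(x z)^(n+1)`.
  have e4 : τ (z * w * x) = 0 := by
    refine (key z x).unique ((hasSum_zero).congr_fun fun n => ?_)
    rw [hτ.trace, ← mul_assoc, ← pow_succ', hword]
  simp only [one_mul, mul_one] at e1 e2 e3 e4
  simp only [add_mul, mul_add, one_mul, mul_smul_comm, mul_one, map_add, map_smul, smul_eq_mul, e1,
    e2, e3, e4]
  ring

end IsFreePair

/-- The resolvent is a norm limit of elements of `T` and need not lie in `T`; hence the passage to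
closures. -/
theorem mem_closure_inverse_one_sub {b : A} (hb : b ∈ T) (hb1 : ‖b‖ < 1) :
    Ring.inverse (1 - b) ∈ closure (T : Set A) := by
  rw [NormedRing.inverse_one_sub _ hb1]
  exact mem_closure_of_tendsto (summable_geometric_of_norm_lt_one hb1).hasSum
    (Filter.Eventually.of_forall fun s => sum_mem fun n _ => pow_mem hb n)

theorem represents_apply_inverse (hτ : IsTracialState τ) (a : A) :
    Represents (PowerSeries.mk fun n => τ (a ^ n)) fun z => τ (Ring.inverse (1 - z • a)) := by
  have hlt : ∀ᶠ z in 𝓝 (0 : ℂ), ‖z • a‖ < 1 :=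
    (ContinuousAt.norm (by fun_prop)).eventually_lt continuousAt_const (by simp)
  filter_upwards [hlt] with z hz
  have h1 := (summable_geometric_of_norm_lt_one hz).hasSum.map τ hτ.continuous
  rw [NormedRing.inverse_one_sub _ hz]
  refine h1.congr_fun fun n => ?_
  simp [smul_pow, mul_comm]

/-- The algebraic identity behind the computation of the resolvent of a product of free elements,
one of which is a projection `P`. -/
theorem resolvent_factorization {P b σ z x : A} {t y α : ℂ} (hP : P * P = P) (hα : α ≠ 0)
    (hy1 : 1 + y ≠ 0) (hyα : α + y ≠ 0) (hσ : (1 - t • b) * σ = 1)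
    (hz : z = (1 + y)⁻¹ • σ - 1) (hx : x = α⁻¹ • P - 1) :
    (((1 + y) • (1 : A) + y • x) * ((1 - (t * ((1 + y) / (α + y))) • (P * b)) * (1 + z))) =
      1 - x * z := by
  have hσ' : t • (b * σ) = σ - 1 := by
    rw [sub_mul, one_mul, smul_mul_assoc] at hσ
    rw [← hσ]; abel
  have e1 : (1 - (t * ((1 + y) / (α + y))) • (P * b)) * (1 + z) =
      (1 + y)⁻¹ • σ - ((1 + y)⁻¹ * ((1 + y) / (α + y))) • (P * (σ - 1)) := by
    rw [← hσ', hz, add_sub_cancel, sub_mul, one_mul, mul_smul_comm, smul_mul_assoc, mul_smul_comm,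
      smul_smul, smul_smul, mul_assoc]
    congr 2
    ring
  rw [e1, hz, hx]
  simp only [mul_sub, sub_mul, add_mul, mul_smul_comm, smul_mul_assoc, one_mul, mul_one, ← mul_assoc,
    hP, smul_sub, smul_smul]
  match_scalars <;> field_simp <;> ring

/-- The resolvent of the product of a projection and a free element. -/
theorem IsFreePair.eventually_apply_inverse (h : IsFreePair τ S T) (hτ : IsTracialState τ)
    {P b : A} (hPS : P ∈ S) (hP : P * P = P) (hb : b ∈ T) {α : ℂ} (hα : α ≠ 0) (hPα : τ P = α) :
    ∀ᶠ t in 𝓝 (0 : ℂ), τ (Ring.inverse (1 - (t * (τ (Ring.inverse (1 - t • b)) /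
      (α + (τ (Ring.inverse (1 - t • b)) - 1)))) • (P * b))) = τ (Ring.inverse (1 - t • b)) := by
  set σ : ℂ → A := fun t => Ring.inverse (1 - t • b) with hσ
  have hσ0 : σ 0 = 1 := by simp [hσ]
  have hσc : ContinuousAt σ 0 :=
    (spectrum.hasFPowerSeriesOnBall_inverse_one_sub_smul ℂ b).analyticAt.continuousAt
  have hmc : ContinuousAt (fun t => τ (σ t)) 0 := hτ.continuous.continuousAt.comp hσc
  have hm0 : τ (σ 0) = 1 := by rw [hσ0, hτ.map_one]
  set x : A := α⁻¹ • P - 1 with hx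
  have hxS : x ∈ S := sub_mem (S.smul_mem hPS _) (one_mem S)
  have hx0 : τ x = 0 := by simp [hx, hPα, hτ.map_one, hα]
  have hdc : ContinuousAt (fun t => α + (τ (σ t) - 1)) 0 :=
    continuousAt_const.add (hmc.sub continuousAt_const)
  have hd0 : α + (τ (σ 0) - 1) ≠ 0 := by simpa [hm0] using hα
  have hzc : ContinuousAt (fun t => x * ((τ (σ t))⁻¹ • σ t - 1)) 0 :=
    continuousAt_const.mul (((hmc.inv₀ (by simp [hm0])).smul hσc).sub continuousAt_const)
  have hζc : ContinuousAt (fun t => (t * (τ (σ t) / (α + (τ (σ t) - 1)))) • (P * b)) 0 :=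
    (continuousAt_id.mul (hmc.div hdc hd0)).smul continuousAt_const
  have v1 : ∀ᶠ t in 𝓝 (0 : ℂ), ‖t • b‖ < 1 :=
    (ContinuousAt.norm (by fun_prop)).eventually_lt continuousAt_const (by simp)
  have v2 : ∀ᶠ t in 𝓝 (0 : ℂ), τ (σ t) ≠ 0 := hmc.eventually_ne (by simp [hm0])
  have v3 := hdc.eventually_ne hd0
  have v4 := hzc.norm.eventually_lt (continuousAt_const (y := (1 : ℝ))) (by simp [hσ0, hτ.map_one])
  have v5 := hζc.norm.eventually_lt (continuousAt_const (y := (1 : ℝ))) (by simp)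
  filter_upwards [v1, v2, v3, v4, v5] with t h1 h2 h3 h4 h5
  have hσt : (1 - t • b) * σ t = 1 := Ring.mul_inverse_cancel _ (isUnit_one_sub_of_norm_lt_one h1)
  set y := τ (σ t) - 1 with hy
  have hy1 : τ (σ t) = 1 + y := by rw [hy]; ring
  rw [hy1] at h2 h4 h5 ⊢
  set z : A := (1 + y)⁻¹ • σ t - 1 with hz
  have hzT : z ∈ closure (T : Set A) := by
    have h6 : σ t ∈ T.topologicalClosure := mem_closure_inverse_one_sub (T.smul_mem hb t) h1
    exact sub_mem (S := StarSubalgebra ℂ A) (T.topologicalClosure.smul_mem h6 (1 + y)⁻¹) (one_mem _)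
  have hz0 : τ z = 0 := by
    rw [hz, map_sub, map_smul, hy1, hτ.map_one, smul_eq_mul, inv_mul_cancel₀ h2, sub_self]
  have hfac := resolvent_factorization hP hα h2 h3 hσt hz hx
  set u : A := 1 - (t * ((1 + y) / (α + y))) • (P * b) with hu
  have huU : IsUnit u := isUnit_one_sub_of_norm_lt_one h5
  set w := Ring.inverse (1 - x * z) with hw
  have hxw : (1 - x * z) * w = 1 := Ring.mul_inverse_cancel _ (isUnit_one_sub_of_norm_lt_one h4)
  set ρ : A := (1 + y) • (1 : A) + y • x with hρ
  -- A left inverse of `ρ` must coincide with its right inverse `u (1 + z) w`. Thus `u (1 + z) w ρ =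
  -- 1`, which identifies the inverse of the unit `u`.
  have hρ' : (1 - (y / (α + y)) • P) * ρ = 1 := by
    rw [hρ, hx]
    simp only [mul_sub, sub_mul, mul_add, mul_smul_comm, smul_mul_assoc, one_mul, mul_one, hP,
      smul_sub, smul_smul]
    match_scalars <;> field_simp <;> ring
  have hr : ρ * (u * ((1 + z) * w)) = 1 := by
    rw [← mul_assoc u, ← mul_assoc, hfac, hxw]
  have huG : u * ((1 + z) * w * ρ) = 1 := by
    have h7 := left_inv_eq_right_inv hρ' hr
    rw [← mul_assoc, ← h7, hρ']
  have hG : Ring.inverse u = (1 + z) * w * ρ :=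
    left_inv_eq_right_inv (Ring.inverse_mul_cancel _ huU) huG
  rw [hG]
  exact h.apply_resolvent hτ hxS hx0 hzT hz0 h4 _ _

end Compression

/-! ### Moments of the compressed Brownian motion -/

section Compression

open Topology PowerSeries

variable {A : Type*} [CStarAlgebra A] {τ : A →ₗ[ℂ] ℂ} {Y : ℝ≥0 → A}

/-- The rescaling by `e^{t/2}` turns `τ(Y_t^n)` into `Q_n(t)`; subtracting `1` removes the constant
term. -/
theorem IsFreeUnitaryBrownianMotion.represents (hY : IsFreeUnitaryBrownianMotion τ Y)
    (hτ : IsTracialState τ) (t : ℝ≥0) :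
    Represents (PowerSeries.mk (lagrangeCoeff (phi (t : ℝ)) X)) fun w =>
      τ (Ring.inverse (1 - (Complex.exp ((t : ℝ) / 2) * w) • Y t)) - 1 := by
  have hc : Filter.Tendsto (fun w : ℂ => Complex.exp ((t : ℝ) / 2) * w) (𝓝 0) (𝓝 0) := by
    simpa using (continuous_const.mul continuous_id).tendsto (0 : ℂ)
      (f := fun w : ℂ => Complex.exp ((t : ℝ) / 2) * w)
  filter_upwards [hc.eventually (represents_apply_inverse hτ (Y t))] with w hw
  have h1 := hw.sub (hasSum_single (f := fun n : ℕ => if n = 0 then (1 : ℂ) else 0) 0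
    fun n hn => if_neg hn)
  rw [if_pos rfl] at h1
  refine h1.congr_fun fun n => ?_
  rcases Nat.eq_zero_or_pos n with rfl | hn
  · simp [lagrangeCoeff, hτ.map_one]
  · rw [coeff_mk, ← hY.momentQ_eq hτ n hn, momentQ, coeff_mk, if_neg (by omega), sub_zero, mul_pow,
      ← Complex.exp_nat_mul]
    rw [mul_div_assoc]
    ring

/-- The moments of the compression of a free unitary Brownian motion by a free projection. -/
theorem IsFreeUnitaryBrownianMotion.apply_compression_pow (hY : IsFreeUnitaryBrownianMotion τ Y)
    (hτ : IsTracialState τ) {P : A} (hP : IsStarProjection P) {α : ℝ≥0} (hα : 0 < α)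
    (hPα : τ P = ((α : ℝ) : ℂ)) (hfree : IsStarFree τ {P} (Set.range Y)) {n : ℕ} (hn : 1 ≤ n)
    (t : ℝ≥0) : τ ((P * Y t) ^ n) =
      ((α : ℝ) : ℂ) * Complex.exp (-(n : ℂ) * ((t : ℝ) : ℂ) / 2) * momentQ τ Y n (α * t) := by
  have hα0 : ((α : ℝ) : ℂ) ≠ 0 := by exact_mod_cast hα.ne'
  set a : ℂ := ((α : ℝ) : ℂ) with ha
  set T : ℂ := ((t : ℝ) : ℂ) with hT
  set E : ℂ := Complex.exp (T / 2) with hE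
  have hr1 := hY.represents hτ t
  have hr2 := hY.represents hτ (α * t)
  rw [← hT, ← hE] at hr1
  rw [NNReal.coe_mul, Complex.ofReal_mul, ← ha, ← hT] at hr2
  set Ψ : ℂ → ℂ := fun w => τ (Ring.inverse (1 - (Complex.exp (a * T / 2) * w) • Y (α * t))) - 1
    with hΨ
  set N : ℂ → ℂ := fun z => τ (Ring.inverse (1 - z • (P * Y t))) with hN
  have hNr : Represents (PowerSeries.mk fun n => τ ((P * Y t) ^ n)) N :=
    represents_apply_inverse hτ _
  have hNE : Represents (PowerSeries.mk fun n => τ ((P * Y t) ^ n) * E ^ n) fun v => N (E * v) := by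
    have hc : Filter.Tendsto (fun v : ℂ => E * v) (𝓝 0) (𝓝 0) := by
      simpa using (continuous_const.mul continuous_id).tendsto (0 : ℂ) (f := fun v : ℂ => E * v)
    filter_upwards [hc.eventually hNr] with v hv
    refine hv.congr_fun fun n => ?_
    rw [coeff_mk, coeff_mk, mul_pow]
    ring
  have hΨa : Represents (C 1 + C a * PowerSeries.mk (lagrangeCoeff (phi (a * T)) X))
      fun v => 1 + a * Ψ v :=
    (Represents.const 1).add ((Represents.const a).mul hr2)
  set F : ℂ → ℂ → ℂ := fun s y => y * ((1 + y) * Complex.exp (-s * y))⁻¹ with hF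
  have hF0 : ∀ s, F s 0 = 0 := fun s => by simp [hF]
  have hFc : ∀ s, ContinuousAt (F s) 0 := fun s =>
    continuousAt_id.mul (ContinuousAt.inv₀ (by fun_prop) (by simp))
  have hstat := IsFreePair.eventually_apply_inverse hfree hτ
    (StarAlgebra.subset_adjoin ℂ _ (Set.mem_singleton P)) hP.isIdempotentElem.eq
    (StarAlgebra.subset_adjoin ℂ _ (Set.mem_range_self t)) hα0 hPα
  have hau : Filter.Tendsto (fun u : ℂ => a * u) (𝓝 0) (𝓝 0) := by
    simpa using (continuous_const.mul continuous_id).tendsto (0 : ℂ) (f := fun u : ℂ => a * u)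
  have hEF : Filter.Tendsto (fun u : ℂ => E * F T (a * u)) (𝓝 0) (𝓝 0) := by
    have h1 : Filter.Tendsto (F T) (𝓝 0) (𝓝 0) := by
      simpa only [ContinuousAt, hF0] using hFc T
    simpa using (h1.comp hau).const_mul E
  have hu1 : ∀ᶠ u in 𝓝 (0 : ℂ), 1 + u ≠ 0 :=
    ContinuousAt.eventually_ne (by fun_prop) (by simp)
  have hu2 : ∀ᶠ u in 𝓝 (0 : ℂ), 1 + a * u ≠ 0 :=
    ContinuousAt.eventually_ne (by fun_prop) (by simp)
  have key : ∀ᶠ u in 𝓝 (0 : ℂ), N (E * F (a * T) u) = 1 + a * Ψ (F (a * T) u) := by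
    filter_upwards [hau.eventually hr1.eventually_apply_eq, hr2.eventually_apply_eq,
      hEF.eventually hstat, hu1, hu2] with u h1 h2 h3 h4 h5
    have h6 : τ (Ring.inverse (1 - (E * F T (a * u)) • Y t)) = 1 + a * u :=
      (sub_eq_iff_eq_add.mp h1).trans (add_comm _ _)
    rw [h6] at h3
    -- The reparametrization `t ↦ αt`: the factor `1 + αu` cancels the denominator of `F_t(αu)` and
    -- `α(1 + u)` replaces it.
    have h7 : E * F T (a * u) * ((1 + a * u) / (a + (1 + a * u - 1))) = E * F (a * T) u := by
      have h8 : a + (1 + a * u - 1) = a * (1 + u) := by ring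
      have h9 : -T * (a * u) = -(a * T) * u := by ring
      have h10 := Complex.exp_ne_zero (-(a * T) * u)
      rw [h8, hF]
      simp only [h9]
      field_simp
    rw [h7] at h3
    change N (E * F (a * T) u) = _ at h3
    rw [h3]
    change Ψ (F (a * T) u) = u at h2
    rw [h2]
  have hFne : Filter.Tendsto (F (a * T)) (𝓝[≠] 0) (𝓝[≠] 0) := by
    refine tendsto_nhdsWithin_iff.mpr ⟨?_, ?_⟩
    · have h1 : Filter.Tendsto (F (a * T)) (𝓝 0) (𝓝 0) := by
        simpa only [ContinuousAt, hF0] using hFc (a * T)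
      exact h1.mono_left nhdsWithin_le_nhds
    · filter_upwards [self_mem_nhdsWithin, nhdsWithin_le_nhds hu1] with u h1 h2
      exact mul_ne_zero h1 (inv_ne_zero (mul_ne_zero h2 (Complex.exp_ne_zero _)))
  -- Since `F` sends punctured neighbourhoods of `0` into punctured ones, the identity holds at
  -- points accumulating at `0`; the identity theorem does the rest, without inverting `F`.
  have heq : ∀ᶠ v in 𝓝 (0 : ℂ), N (E * v) = 1 + a * Ψ v :=
    (hNE.analyticAt.frequently_eq_iff_eventually_eq hΨa.analyticAt).mp
      (hFne.frequently (key.filter_mono nhdsWithin_le_nhds).frequently)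
  have hcoef := congrArg (coeff n) ((hNE.congr heq).unique hΨa)
  rw [coeff_mk, map_add, coeff_C_mul, coeff_mk, coeff_C, if_neg (by omega), zero_add] at hcoef
  have hQ := hY.momentQ_eq hτ n hn (α * t)
  rw [NNReal.coe_mul, Complex.ofReal_mul, ← ha, ← hT] at hQ
  have hexp : Complex.exp (-(n : ℂ) * T / 2) * E ^ n = 1 := by
    rw [hE, ← Complex.exp_nat_mul, ← Complex.exp_add, ← Complex.exp_zero]
    congr 1; ring
  rw [hQ]
  linear_combination Complex.exp (-(n : ℂ) * T / 2) * hcoef - τ ((P * Y t) ^ n) * hexp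

end Compression

end FreeProb

end

/-! ### The three forms of the moment formula -/

theorem mainTheorem1 {A : Type*} [CStarAlgebra A] (τ : A →ₗ[ℂ] ℂ)
    (hτ : FreeProb.IsTracialState τ)
    (Y : ℝ≥0 → A) (hY : FreeProb.IsFreeUnitaryBrownianMotion τ Y)
    (P : A) (hP : IsStarProjection P)
    (α : ℝ≥0) (hα : 0 < α) (hα1 : α ≤ 1) (hPα : τ P = ((α : ℝ) : ℂ))
    (hfree : FreeProb.IsStarFree τ {P} (Set.range Y)) :
    -- all `n ≥ 0`, the `n`-th power being taken in the corner algebra `P A P`, with unit `P`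
    (∀ (n : ℕ) (t : ℝ≥0),
      τ ((P * Y t) ^ n * P) =
        ((α : ℝ) : ℂ) * Complex.exp (-(n : ℂ) * ((t : ℝ) : ℂ) / 2)
          * FreeProb.momentQ τ Y n (α * t)) ∧
    (∀ (n : ℕ) (t : ℝ≥0), 1 ≤ n →
      τ ((P * Y t) ^ n) =
        ((α : ℝ) : ℂ) * Complex.exp (-(n : ℂ) * ((t : ℝ) : ℂ) / 2)
          * FreeProb.momentQ τ Y n (α * t) ∧
      τ ((P * Y t * P) ^ n) =
        ((α : ℝ) : ℂ) * Complex.exp (-(n : ℂ) * ((t : ℝ) : ℂ) / 2)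
          * FreeProb.momentQ τ Y n (α * t)) ∧
    -- `Q_0 = 1` and `Q_n(t) = L_{n-1}^{(1)}(n t) / n` for `n ≥ 1`
    (∀ t : ℝ≥0, FreeProb.momentQ τ Y 0 t = 1) ∧
    (∀ (n : ℕ) (t : ℝ≥0), 1 ≤ n →
      FreeProb.momentQ τ Y n t =
        FreeProb.laguerre 1 (n - 1) ((n : ℂ) * ((t : ℝ) : ℂ)) / (n : ℂ)) := by
  have hPP : P * P = P := hP.isIdempotentElem.eq
  have hQ0 : ∀ t : ℝ≥0, FreeProb.momentQ τ Y 0 t = 1 := fun t => by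
    simp [FreeProb.momentQ, hτ.map_one]
  have hpow : ∀ (n : ℕ) (t : ℝ≥0), 1 ≤ n → τ ((P * Y t) ^ n * P) = τ ((P * Y t) ^ n) := by
    intro n t hn
    obtain ⟨m, rfl⟩ := Nat.exists_eq_add_of_le' hn
    rw [hτ.trace, pow_succ', ← mul_assoc, ← mul_assoc, hPP]
  have hmain : ∀ (n : ℕ) (t : ℝ≥0), 1 ≤ n → τ ((P * Y t) ^ n) =
      ((α : ℝ) : ℂ) * Complex.exp (-(n : ℂ) * ((t : ℝ) : ℂ) / 2)
        * FreeProb.momentQ τ Y n (α * t) :=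
    fun n t hn => hY.apply_compression_pow hτ hP hα hPα hfree hn t
  -- The exponent is shifted because at exponent `0` the left side is `1` and the right side is `P`.
  have hcorner : ∀ (n : ℕ) (t : ℝ≥0), (P * Y t * P) ^ (n + 1) = (P * Y t) ^ (n + 1) * P := by
    intro n t
    induction n with
    | zero => simp
    | succ n ih =>
      have h1 : P * (P * Y t * P) = P * Y t * P := by rw [← mul_assoc, ← mul_assoc, hPP]
      rw [pow_succ, ih, mul_assoc, h1, pow_succ (P * Y t) (n + 1), mul_assoc ((P * Y t) ^ (n + 1))]
  refine ⟨fun n t => ?_, fun n t hn => ⟨hmain n t hn, ?_⟩, hQ0, fun n t hn => ?_⟩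
  · rcases Nat.eq_zero_or_pos n with rfl | hn
    · simp [hQ0, hPα]
    · rw [hpow n t hn, hmain n t hn]
  · obtain ⟨m, rfl⟩ := Nat.exists_eq_add_of_le' hn
    rw [hcorner, hpow _ t hn, hmain _ t hn]
  · rw [hY.momentQ_eq hτ n hn, FreeProb.lagrangeCoeff_phi_X_eq_laguerre _ hn]
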